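/- **Setting.** Let $G=(V,E)$ be a finite simple graph with totally ordered vertex set (edges are written $\langle i,j\rangle$ with $i<j$; subgraphs inherit the order, which plays no role when $u$ is symmetric), and let $v:\{0,1\}\to\mathbb R$, $u:\{0,1\}^2\to\mathbb R$. Put $C_G(x)=\sum_{i\in V}v(x_i)+\sum_{\langle i,j\rangle\in E}u(x_i,x_j)$ for $x\in\{0,1\}^V$. On $(\mathbb C^2)^{\otimes V}$ let $H_0=-\sum_{i\in V}X_i$ ($X_i$ the bit flip on qubit $i$), let $H_1$ be given by $H_1|x\rangle=-C_G(x)|x\rangle$, and for a runtime $T>0$ let $H(t)=(1-\tfrac tT)H_0+\tfrac tT H_1$. Let $U^G_{0,t}$ be the solution of $i\,\partial_tU^G_{0,t}=H(t)U^G_{0,t}$, $U^G_{0,0}=I$, and $|\psi^G(T)\rangle=U^G_{0,T}|\psi_0\rangle$, where $|\psi_0\rangle$ is the uniform superposition of all bit strings. For a subgraph $X$ of $G$, an observable on $X$ is a Hermitian operator $O_X$ on the qubits of $X$; on the qubits of a larger vertex set it acts as $O_X\otimes I$. Let $B_r$ be the neighbourhood of $X$ at distance $r$: the subgraph of $G$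 consisting of $X$ and of all vertices and edges that lie on a path of $G$ of length at most $r$ with an end-point in $X$. Annealing on $B_r$ means the same procedure applied to the graph $B_r$ on its own qubits, and for $\Lambda\in\{G,B_r\}$ we write $E_\Lambda(T)=\langle\psi^\Lambda(T)|O_X|\psi^\Lambda(T)\rangle$. Norms are operator norms. **Corollary.** Fix $v$, $u$, a degree bound $d$ and a size bound $m$. 1. For every $\varepsilon>0$, $T>0$ and $K$ there is a radius $r(\varepsilon,T)$, depending otherwise only on $v,u,d,m,K$, such that for every $r\ge r(\varepsilon,T)$ (in particular for $r=r(\varepsilon,T)$), every finite graph $G$ of maximum degree at most $d$, every subgraph $X$ of $G$ with at most $m$ vertices and every observable $O_X$ on $X$ with $\|O_X\|\le K$, $$|E_G(T)-E_{B_r}(T)|\le\varepsilon .$$ 2. There are constants $v_{LR},\mu,C>0$, depending only on $v,u,d,m$, such that for every such $G$ and $X$, every observable $O_X$ on $X$, every $T>0$ and every integer $r\ge v_{LR}T$, $$\bigl\|(U^G_{0,T})^\dagger O_XU^G_{0,T}-(U^{B_r}_{0,T})^\dagger O_XU^{B_r}_{0,T}\bigr\|\le C\,\|O_X\|\,e^{-\mu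 r},$$ where the second operator acts as the identity on the qubits outside $B_r$. -/

import Mathlib

open scoped Matrix.Norms.L2Operator

namespace QuantumAnnealing

/-! ### Linear differential equations with an affine generator

Existence of a global solution of `U' = (a + t b) U`, `U 0 = 1`, needed so that the annealing
evolution below is a well-defined object. -/

section AffineODE

variable {A : Type*} [NormedRing A] [NormedAlgebra ℝ A]

/-- Taylor coefficients of the solution of `U' = (a + t b) U`, `U 0 = 1`. -/
noncomputable def affineCoeff (a b : A) : ℕ → A
  | 0 => 1
  | 1 => a
  | n + 2 => ((n : ℝ) + 2)⁻¹ • (a * affineCoeff a b (n + 1) + b * affineCoeff a b n)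

theorem affineCoeff_bound (a b : A) {ρ : ℝ} (hρ : 0 < ρ) :
    ∃ C : ℝ, ∀ n, ‖affineCoeff a b n‖ ≤ C * ρ ^ n := by
  obtain ⟨N, hN⟩ := exists_nat_ge (‖a‖ / ρ + ‖b‖ / ρ ^ 2)
  set C : ℝ := ∑ k ∈ Finset.range (N + 2), ‖affineCoeff a b k‖ / ρ ^ k with hC
  have hC0 : 0 ≤ C := Finset.sum_nonneg fun k _ => by positivity
  refine ⟨C, fun n => ?_⟩
  induction n using Nat.strong_induction_on with
  | _ n ih =>
    by_cases hn : n < N + 2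
    · have h1 : ‖affineCoeff a b n‖ / ρ ^ n ≤ C :=
        Finset.single_le_sum (f := fun k => ‖affineCoeff a b k‖ / ρ ^ k)
          (fun k _ => by positivity) (Finset.mem_range.2 hn)
      rwa [div_le_iff₀ (by positivity)] at h1
    · obtain ⟨m, rfl⟩ : ∃ m, n = m + 2 := ⟨n - 2, by omega⟩
      have i1 := ih (m + 1) (by omega)
      have i0 := ih m (by omega)
      have hNm : (N : ℝ) ≤ m := by exact_mod_cast (by omega : N ≤ m)
      have h1 : ‖a * affineCoeff a b (m + 1) + b * affineCoeff a b m‖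
          ≤ ‖a‖ * (C * ρ ^ (m + 1)) + ‖b‖ * (C * ρ ^ m) :=
        (norm_add_le _ _).trans (add_le_add
          ((norm_mul_le _ _).trans (by gcongr)) ((norm_mul_le _ _).trans (by gcongr)))
      have h2 : ‖a‖ * (C * ρ ^ (m + 1)) + ‖b‖ * (C * ρ ^ m)
          = (‖a‖ / ρ + ‖b‖ / ρ ^ 2) * (C * ρ ^ (m + 2)) := by
        field_simp
        ring
      have h3 : (‖a‖ / ρ + ‖b‖ / ρ ^ 2) * (C * ρ ^ (m + 2))
          ≤ ((m : ℝ) + 2) * (C * ρ ^ (m + 2)) := by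
        apply mul_le_mul_of_nonneg_right _ (by positivity)
        linarith
      rw [affineCoeff, norm_smul, Real.norm_of_nonneg (by positivity),
        inv_mul_le_iff₀ (by positivity)]
      exact h1.trans (h2.le.trans h3)

theorem affineCoeff_summable [CompleteSpace A] (a b : A) (t : ℝ) :
    Summable fun n => t ^ n • affineCoeff a b n := by
  obtain ⟨C, hC⟩ := affineCoeff_bound a b (ρ := (2 * (|t| + 1))⁻¹) (by positivity)
  refine Summable.of_norm_bounded (g := fun n => C * (1 / 2 : ℝ) ^ n)
    (summable_geometric_two.mul_left C) fun n => ?_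
  rw [norm_smul, norm_pow, Real.norm_eq_abs]
  calc |t| ^ n * ‖affineCoeff a b n‖
      ≤ (|t| + 1) ^ n * (C * (2 * (|t| + 1))⁻¹ ^ n) := by
        gcongr
        · linarith
        · exact hC n
    _ = C * (1 / 2 : ℝ) ^ n := by
        have : (|t| + 1) ≠ 0 := by positivity
        rw [mul_left_comm, ← mul_pow]
        congr 2
        field_simp

theorem affineCoeff_deriv_bound (a b : A) {R : ℝ} (hR : 0 < R) :
    ∃ C : ℝ, ∀ (n : ℕ) (y : ℝ), |y| ≤ R →
      ‖((n : ℝ) * y ^ (n - 1)) • affineCoeff a b n‖ ≤ C * ((n : ℝ) ^ 1 * (1 / 2 : ℝ) ^ n) := by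
  obtain ⟨C, hC⟩ := affineCoeff_bound a b (ρ := (2 * R)⁻¹) (by positivity)
  refine ⟨C / R, fun n y hy => ?_⟩
  rcases n with _ | n
  · simp
  · rw [norm_smul, norm_mul, norm_pow, Real.norm_eq_abs, Real.norm_eq_abs, Nat.abs_cast,
      Nat.add_sub_cancel]
    calc ((n + 1 : ℕ) : ℝ) * |y| ^ n * ‖affineCoeff a b (n + 1)‖
        ≤ ((n + 1 : ℕ) : ℝ) * R ^ n * (C * (2 * R)⁻¹ ^ (n + 1)) := by
          gcongr
          exact hC _
      _ = (C / R) * (((n + 1 : ℕ) : ℝ) ^ 1 * (1 / 2 : ℝ) ^ (n + 1)) := by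
          rw [inv_pow, mul_pow, one_div, inv_pow, pow_succ R n]
          field_simp

theorem exists_affine_solution [CompleteSpace A] (a b : A) :
    ∃ U : ℝ → A, U 0 = 1 ∧ ∀ t, HasDerivAt U ((a + t • b) * U t) t := by
  refine ⟨fun t => ∑' n : ℕ, t ^ n • affineCoeff a b n, ?_, fun t => ?_⟩
  · show ∑' n : ℕ, (0 : ℝ) ^ n • affineCoeff a b n = 1
    rw [tsum_eq_single 0 (by intro n hn; simp [hn])]
    simp [affineCoeff]
  · have hR0 : 0 < |t| + 1 := by positivity
    obtain ⟨C, hC⟩ := affineCoeff_deriv_bound a b hR0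
    have hu : Summable fun n : ℕ => C * ((n : ℝ) ^ 1 * (1 / 2 : ℝ) ^ n) :=
      (summable_pow_mul_geometric_of_norm_lt_one (R := ℝ) 1 (r := 1 / 2) (by
        rw [Real.norm_eq_abs]; norm_num)).mul_left C
    have key : HasDerivAt (fun t : ℝ => ∑' n : ℕ, t ^ n • affineCoeff a b n)
        (∑' n : ℕ, ((n : ℝ) * t ^ (n - 1)) • affineCoeff a b n) t := by
      have hg : ∀ (n : ℕ) (y : ℝ), y ∈ Metric.ball (0 : ℝ) (|t| + 1) →
          HasDerivAt (fun t : ℝ => t ^ n • affineCoeff a b n)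
            (((n : ℝ) * y ^ (n - 1)) • affineCoeff a b n) y :=
        fun n y _ => (hasDerivAt_pow n y).smul_const _
      have hg' : ∀ (n : ℕ) (y : ℝ), y ∈ Metric.ball (0 : ℝ) (|t| + 1) →
          ‖((n : ℝ) * y ^ (n - 1)) • affineCoeff a b n‖ ≤ C * ((n : ℝ) ^ 1 * (1 / 2 : ℝ) ^ n) :=
        fun n y hy => hC n y (mem_ball_zero_iff.1 hy).le
      have ht : t ∈ Metric.ball (0 : ℝ) (|t| + 1) := by
        rw [mem_ball_zero_iff, Real.norm_eq_abs]
        linarith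
      exact hasDerivAt_tsum_of_isPreconnected hu Metric.isOpen_ball
        (convex_ball (0 : ℝ) (|t| + 1)).isPreconnected hg hg' ht (affineCoeff_summable a b t) ht
    have hs := affineCoeff_summable a b t
    have hd : Summable fun n : ℕ => ((n : ℝ) * t ^ (n - 1)) • affineCoeff a b n :=
      Summable.of_norm_bounded hu fun n => hC n t (by linarith)
    have hd1 := (summable_nat_add_iff 1).2 hd
    have ha := hs.mul_left a
    have hb := (hs.mul_left b).const_smul t
    have ha1 := (summable_nat_add_iff 1).2 ha
    have e : (a + t • b) * ∑' n : ℕ, t ^ n • affineCoeff a b n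
        = ∑' n : ℕ, ((n : ℝ) * t ^ (n - 1)) • affineCoeff a b n := by
      rw [hd.tsum_eq_zero_add, hd1.tsum_eq_zero_add, add_mul, smul_mul_assoc,
        ← hs.tsum_mul_left a, ← hs.tsum_mul_left b, ← (hs.mul_left b).tsum_const_smul t,
        ha.tsum_eq_zero_add, add_assoc, ← ha1.tsum_add hb]
      have e0 : a * t ^ 0 • affineCoeff a b 0 = ((0 + 1 : ℕ) : ℝ) • t ^ (0 + 1 - 1) •
          affineCoeff a b (0 + 1) := by
        simp [affineCoeff]
      have e1 : ∀ n : ℕ, a * t ^ (n + 1) • affineCoeff a b (n + 1)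
          + t • (b * t ^ n • affineCoeff a b n)
          = (((n + 1 + 1 : ℕ) : ℝ) * t ^ (n + 1 + 1 - 1)) • affineCoeff a b (n + 1 + 1) := by
        intro n
        have hn : ((n : ℝ) + 2) ≠ 0 := by positivity
        have hc : ((n + 1 + 1 : ℕ) : ℝ) * t ^ (n + 1 + 1 - 1) * ((n : ℝ) + 2)⁻¹ = t ^ (n + 1) := by
          rw [Nat.add_sub_cancel]
          push_cast
          field_simp
          ring
        rw [affineCoeff, smul_smul, hc, smul_add, mul_smul_comm, mul_smul_comm, smul_smul,
          ← pow_succ']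
      rw [tsum_congr e1, e0, smul_smul]
      simp
    have e' : (a + t • b) * (fun t : ℝ => ∑' n : ℕ, t ^ n • affineCoeff a b n) t
        = ∑' n : ℕ, ((n : ℝ) * t ^ (n - 1)) • affineCoeff a b n := e
    rw [e']
    exact key

end AffineODE

/-! ### Quantum annealing on a graph

The qubits are indexed by the vertices, a computational basis state is a bit string `V → Bool`
and operators are matrices indexed by bit strings; norms of operators are operator norms for the
Euclidean norm. The vertex set is linearly ordered: an edge is written `⟨i, j⟩` with `i < j`, so
that the edge cost `u (x i) (x j)` is meaningful also when `u` is not symmetric. -/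

section Annealing

variable {V : Type*} [Fintype V] [LinearOrder V]

open Classical in
/-- `C(x) = ∑ᵢ v(xᵢ) + ∑_{⟨i,j⟩ ∈ E} u(xᵢ, xⱼ)`. -/
noncomputable def cost (v : Bool → ℝ) (u : Bool → Bool → ℝ) (G : SimpleGraph V)
    (x : V → Bool) : ℝ :=
  ∑ i, v (x i) + ∑ i, ∑ j, if i < j ∧ G.Adj i j then u (x i) (x j) else 0

/-- The bit-flip (Pauli `X`) operator on qubit `i`. -/
def bitFlip (i : V) : Matrix (V → Bool) (V → Bool) ℂ :=
  Matrix.of fun x y => if x = Function.update y i (!y i) then 1 else 0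

/-- `H₀ = -∑ᵢ Xᵢ`. -/
def initialHamiltonian (V : Type*) [Fintype V] [LinearOrder V] :
    Matrix (V → Bool) (V → Bool) ℂ :=
  -∑ i, bitFlip i

/-- `H₁ |x⟩ = -C(x) |x⟩`. -/
noncomputable def targetHamiltonian (v : Bool → ℝ) (u : Bool → Bool → ℝ) (G : SimpleGraph V) :
    Matrix (V → Bool) (V → Bool) ℂ :=
  Matrix.diagonal fun x => -(cost v u G x : ℂ)

/-- `H(t) = (1 - t/T) H₀ + (t/T) H₁`. -/
noncomputable def hamiltonian (v : Bool → ℝ) (u : Bool → Bool → ℝ) (G : SimpleGraph V)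
    (T t : ℝ) : Matrix (V → Bool) (V → Bool) ℂ :=
  (1 - t / T) • initialHamiltonian V + (t / T) • targetHamiltonian v u G

/-- The Schrödinger equation `i dU/dt = H(t) U` for the evolution operator, with `U(0) = I`.
The Hamiltonian is extended by its formula beyond `[0, T]`; this does not affect `U` there. -/
def IsEvolution (H U : ℝ → Matrix (V → Bool) (V → Bool) ℂ) : Prop :=
  U 0 = 1 ∧ ∀ t, HasDerivAt U ((-Complex.I) • (H t * U t)) t

theorem exists_isEvolution (v : Bool → ℝ) (u : Bool → Bool → ℝ) (G : SimpleGraph V) (T : ℝ) :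
    ∃ U, IsEvolution (hamiltonian v u G T) U := by
  obtain ⟨U, h0, h⟩ := exists_affine_solution ((-Complex.I) • initialHamiltonian V)
    ((-Complex.I) • (T⁻¹ • (targetHamiltonian v u G - initialHamiltonian V)))
  refine ⟨U, h0, fun t => ?_⟩
  have e : (-Complex.I) • (hamiltonian v u G T t * U t)
      = ((-Complex.I) • initialHamiltonian V +
        t • ((-Complex.I) • (T⁻¹ • (targetHamiltonian v u G - initialHamiltonian V)))) * U t := by
    rw [← smul_mul_assoc, smul_comm t (-Complex.I), ← smul_add, hamiltonian]
    congr 2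
    module
  rw [e]
  exact h t

/-- The evolution operator `U_{0,t}` of the annealing on `G` with running time `T`. -/
noncomputable def evolution (v : Bool → ℝ) (u : Bool → Bool → ℝ) (G : SimpleGraph V) (T : ℝ) :
    ℝ → Matrix (V → Bool) (V → Bool) ℂ :=
  Classical.choose (exists_isEvolution v u G T)

theorem evolution_spec (v : Bool → ℝ) (u : Bool → Bool → ℝ) (G : SimpleGraph V) (T : ℝ) :
    IsEvolution (hamiltonian v u G T) (evolution v u G T) :=
  Classical.choose_spec (exists_isEvolution v u G T)

/-- The uniform superposition of all bit strings. -/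
noncomputable def uniformState (V : Type*) [Fintype V] : (V → Bool) → ℂ :=
  fun _ => ((Real.sqrt 2 : ℝ) : ℂ)⁻¹ ^ Fintype.card V

/-- The final state `|ψ^G(T)⟩ = U_{0,T} |ψ₀⟩`. -/
noncomputable def finalState (v : Bool → ℝ) (u : Bool → Bool → ℝ) (G : SimpleGraph V) (T : ℝ) :
    (V → Bool) → ℂ :=
  Matrix.mulVec (evolution v u G T T) (uniformState V)

/-- The expected value `⟨ψ^G(T)| A |ψ^G(T)⟩`. -/
noncomputable def expectedValue (v : Bool → ℝ) (u : Bool → Bool → ℝ) (G : SimpleGraph V) (T : ℝ)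
    (A : Matrix (V → Bool) (V → Bool) ℂ) : ℂ :=
  dotProduct (star (finalState v u G T)) (Matrix.mulVec A (finalState v u G T))

/-- The Heisenberg-evolved operator `U_{0,T}† A U_{0,T}`. -/
noncomputable def heisenberg (v : Bool → ℝ) (u : Bool → Bool → ℝ) (G : SimpleGraph V) (T : ℝ)
    (A : Matrix (V → Bool) (V → Bool) ℂ) : Matrix (V → Bool) (V → Bool) ℂ :=
  (evolution v u G T T).conjTranspose * A * evolution v u G T T

end Annealing

open Classical in
/-- For an injection `f : ι → V` of qubits, the operator `O ⊗ I` that acts as `O` on the qubits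
in the range of `f` and as the identity on all others. -/
noncomputable def extendOp {ι V : Type*} (f : ι → V) (O : Matrix (ι → Bool) (ι → Bool) ℂ) :
    Matrix (V → Bool) (V → Bool) ℂ :=
  Matrix.of fun x y => if ∀ i, i ∉ Set.range f → x i = y i then O (x ∘ f) (y ∘ f) else 0

/-! ### Neighbourhoods in a graph -/

section Neighbourhood

variable {V : Type*} {G : SimpleGraph V}

/-- The neighbourhood at distance `r` of a subgraph `X`: it contains `X` and all the vertices and
edges that lie on a path of `G` of length at most `r` with an end-point in `X`. -/
def ball (X : G.Subgraph) (r : ℕ) : G.Subgraph where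
  verts := X.verts ∪ {w | ∃ a ∈ X.verts, ∃ b, ∃ p : G.Walk a b,
    p.IsPath ∧ p.length ≤ r ∧ w ∈ p.support}
  Adj w z := X.Adj w z ∨ ∃ a ∈ X.verts, ∃ b, ∃ p : G.Walk a b,
    p.IsPath ∧ p.length ≤ r ∧ s(w, z) ∈ p.edges
  adj_sub := by
    rintro w z (h | ⟨a, -, b, p, -, -, h⟩)
    · exact X.adj_sub h
    · exact p.adj_of_mem_edges h
  edge_vert := by
    rintro w z (h | ⟨a, ha, b, p, hp, hl, h⟩)
    · exact Or.inl (X.edge_vert h)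
    · exact Or.inr ⟨a, ha, b, p, hp, hl, p.fst_mem_support_of_mem_edges h⟩
  symm := ⟨by
    rintro w z (h | ⟨a, ha, b, p, hp, hl, h⟩)
    · exact Or.inl h.symm
    · exact Or.inr ⟨a, ha, b, p, hp, hl, by rwa [Sym2.eq_swap]⟩⟩

theorem verts_subset_ball (X : G.Subgraph) (r : ℕ) : X.verts ⊆ (ball X r).verts :=
  Set.subset_union_left

noncomputable instance fintypeVerts [Finite V] (Y : G.Subgraph) : Fintype Y.verts :=
  Fintype.ofFinite _

end Neighbourhood

end QuantumAnnealing

/-! The proof is a Lieb–Robinson estimate obtained from a Grönwall inequality for one weighted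
quantity, without iterated commutator series or counting of paths.

Each qubit `w` has two generators, the bit flip and the occupation number. The `oscillation` of an
operator at `w` is the sum of the norms of its commutators with them and measures how much the
operator acts on `w`. Put Φ(a) = ∑ q(w) · oscillation of `a` at `w`, with q(w) = exp(`cappedDist` of
`w`), where `cappedDist` is the distance from `X` cut off at `r`.

Let a = U_T† O U_T and a(s) = U_s a U_s†, so that a(T) = O. The commutator [P_w, a(s)] has the norm
of [U_s† P_w U_s, a], and differentiating replaces P_w by [H(s), P_w], where only the terms of H
touching `w` survive. The Jacobi identity bounds the result by oscillations at `w` and its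
neighbours (`IsLocal.norm_comm_comm_le`). Weights of neighbours differ by a factor at most e, so the
weighted sum of the derivatives is at most κΦ, with κ depending only on `d` and a bound for `v`, `u`
(`IsLocal.sum_weight_mul_norm_comm_comm_le`). Hence Φ(a(s)) ≤ Φ(O) exp(κ(T - s))
(`IsSchrodinger.sum_oscillation_le`), and Φ(O) ≤ 4m‖O‖ because O commutes with all generators off
`X`.

Let W be the evolution on the ball, extended by the identity, with Hamiltonian H_B. The path W_s†
a(s) W_s joins the two Heisenberg operators, and its derivative has norm ‖[H - H_B, a(s)]‖
(`IsSchrodinger.norm_conj_sub_conj_le`). Every term of H - H_B lives on vertices of weight e^r, so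
this norm is at most a constant times e^(-r) Φ(a(s)). Integration gives a bound of order T exp(κT -
r), which is at most exp(-r/2) once r ≥ 2(κ + 1)T.

For expected values, the uniform superposition is a product state, so tensoring with the identity
leaves expectations in it unchanged; the difference is then at most the operator norm just bounded.
-/

namespace QuantumAnnealing

/-! ### Weighted Grönwall inequality -/

section Gronwall

variable {ι E : Type*} [Fintype ι] [NormedAddCommGroup E] [NormedSpace ℝ E]

/-- Backward Grönwall inequality for the sum of the norms of finitely many functions. -/
theorem sum_norm_le_exp_mul_of_sum_norm_deriv_le {f f' : ι → ℝ → E} {κ T : ℝ}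
    (hf : ∀ i s, HasDerivAt (f i) (f' i s) s)
    (bound : ∀ s ∈ Set.Icc 0 T, ∑ i, ‖f' i s‖ ≤ κ * ∑ i, ‖f i s‖) {s : ℝ}
    (hs : s ∈ Set.Icc 0 T) :
    ∑ i, ‖f i s‖ ≤ (∑ i, ‖f i T‖) * Real.exp (κ * (T - s)) := by
  -- In the ℓ¹ product the sum of norms is a single norm, so the vector-valued Grönwall inequality
  -- applies; reversing time moves the known value at `T` to the initial time.
  let g : ℝ → PiLp 1 fun _ : ι => E := fun τ => WithLp.toLp 1 fun i => f i (T - τ)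
  let g' : ℝ → PiLp 1 fun _ : ι => E := fun τ => WithLp.toLp 1 fun i => -f' i (T - τ)
  have hg : ∀ τ, HasDerivAt g (g' τ) τ := by
    intro τ
    have h : HasDerivAt (fun τ i => f i (T - τ)) (fun i => -f' i (T - τ)) τ := by
      rw [hasDerivAt_pi]
      intro i
      have h1 := (hf i (T - τ)).scomp τ ((hasDerivAt_id τ).const_sub T)
      exact h1.congr_deriv (by simp)
    exact ((PiLp.continuousLinearEquiv 1 ℝ fun _ : ι => E).symm.hasFDerivAt).comp_hasDerivAt τ h
  have key := norm_le_gronwallBound_of_norm_deriv_right_le (f := g) (f' := g')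
    (δ := ∑ i, ‖f i T‖) (K := κ) (ε := 0) (a := 0) (b := T)
    (fun τ _ => (hg τ).continuousAt.continuousWithinAt) (fun τ _ => (hg τ).hasDerivWithinAt)
    (by simp [PiLp.norm_eq_of_L1, g]) (fun τ hτ => by
      have := bound (T - τ) ⟨by linarith [hτ.2], by linarith [hτ.1]⟩
      simpa [PiLp.norm_eq_of_L1, g, g'] using this) (T - s) ⟨by linarith [hs.2], by linarith [hs.1]⟩
  rw [gronwallBound_ε0] at key
  simpa [PiLp.norm_eq_of_L1, g] using key

end Gronwall

/-! ### Lieb–Robinson bounds in a C*-algebra -/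

section CStar

variable {A : Type*} [CStarAlgebra A]

/-- The commutator of two operators. -/
def comm (a b : A) : A :=
  a * b - b * a

theorem zero_comm (a : A) : comm 0 a = 0 := by
  simp [comm]

theorem add_comm_left (a b c : A) : comm (a + b) c = comm a c + comm b c := by
  simp only [comm]
  noncomm_ring

theorem sum_comm_left {ι : Type*} (s : Finset ι) (f : ι → A) (a : A) :
    comm (∑ i ∈ s, f i) a = ∑ i ∈ s, comm (f i) a := by
  simp only [comm, Finset.sum_mul, Finset.mul_sum, Finset.sum_sub_distrib]

theorem smul_comm_left (c : ℂ) (a b : A) : comm (c • a) b = c • comm a b := by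
  simp only [comm, smul_mul_assoc, mul_smul_comm, smul_sub]

/-- Jacobi identity. It leaves only commutators of `a` with single local operators, which
oscillations control. -/
theorem comm_comm (h p a : A) : comm (comm h p) a = comm h (comm p a) - comm p (comm h a) := by
  simp only [comm]
  noncomm_ring

theorem norm_comm_le (a b : A) : ‖comm a b‖ ≤ 2 * ‖a‖ * ‖b‖ := by
  rw [comm]
  calc ‖a * b - b * a‖ ≤ ‖a * b‖ + ‖b * a‖ := norm_sub_le _ _
    _ ≤ ‖a‖ * ‖b‖ + ‖b‖ * ‖a‖ := add_le_add (norm_mul_le _ _) (norm_mul_le _ _)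
    _ = 2 * ‖a‖ * ‖b‖ := by ring

theorem norm_comm_comm_le (h p a : A) :
    ‖comm (comm h p) a‖ ≤ 2 * ‖h‖ * ‖comm p a‖ + 2 * ‖p‖ * ‖comm h a‖ := by
  rw [comm_comm]
  exact (norm_sub_le _ _).trans (add_le_add (norm_comm_le _ _) (norm_comm_le _ _))

theorem norm_comm_mul_le (p q a : A) : ‖comm (p * q) a‖ ≤ ‖p‖ * ‖comm q a‖ + ‖comm p a‖ * ‖q‖ := by
  have : (comm (p * q) a) = p * (comm q a) + (comm p a) * q := by
    simp only [comm]
    noncomm_ring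
  rw [this]
  exact (norm_add_le _ _).trans (add_le_add (norm_mul_le _ _) (norm_mul_le _ _))

/-- `U` solves the Schrödinger equation with the Hamiltonian `H`, in an abstract C*-algebra. -/
structure IsSchrodinger (H U : ℝ → A) : Prop where
  zero : U 0 = 1
  deriv : ∀ t, HasDerivAt U ((-Complex.I) • (H t * U t)) t
  selfAdjoint : ∀ t, IsSelfAdjoint (H t)
  unitary : ∀ t, U t ∈ unitary A

variable {H U : ℝ → A}

/-- The derivative of the adjoint of a solution of the Schrödinger equation. -/
theorem hasDerivAt_star_evolution (hU : ∀ t, HasDerivAt U ((-Complex.I) • (H t * U t)) t)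
    (hH : ∀ t, IsSelfAdjoint (H t)) (t : ℝ) :
    HasDerivAt (fun t => star (U t)) (Complex.I • (star (U t) * H t)) t := by
  have := (hU t).star
  simpa [star_smul, (hH t).star_eq] using this

/-- The two terms of the derivative of U†U cancel because `H` is self-adjoint, so the product keeps
its initial value. -/
theorem star_mul_evolution (h0 : U 0 = 1) (hU : ∀ t, HasDerivAt U ((-Complex.I) • (H t * U t)) t)
    (hH : ∀ t, IsSelfAdjoint (H t)) (t : ℝ) : star (U t) * U t = 1 := by
  have hd : ∀ t, HasDerivAt (fun t => star (U t) * U t) 0 t := fun t => by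
    have := (hasDerivAt_star_evolution hU hH t).mul (hU t)
    exact this.congr_deriv (by simp [mul_assoc])
  have := is_const_of_deriv_eq_zero (fun t => (hd t).differentiableAt) (fun t => (hd t).deriv) t 0
  simpa [h0] using this

namespace IsSchrodinger

theorem star_mul (h : IsSchrodinger H U) (t : ℝ) : star (U t) * U t = 1 :=
  Unitary.star_mul_self_of_mem (h.unitary t)

theorem mul_star (h : IsSchrodinger H U) (t : ℝ) : U t * star (U t) = 1 :=
  Unitary.mul_star_self_of_mem (h.unitary t)

theorem norm_conj (h : IsSchrodinger H U) (t : ℝ) (a : A) : ‖star (U t) * a * U t‖ = ‖a‖ := by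
  rw [CStarRing.norm_mul_mem_unitary _ (h.unitary t),
    CStarRing.norm_mem_unitary_mul _ (Unitary.star_mem (h.unitary t))]

/-- The derivative of the Heisenberg evolution of a fixed operator. -/
theorem hasDerivAt_conj (h : IsSchrodinger H U) (p : A) (t : ℝ) :
    HasDerivAt (fun t => star (U t) * p * U t)
      (Complex.I • (star (U t) * (comm (H t) p) * U t)) t := by
  have := ((hasDerivAt_star_evolution h.deriv h.selfAdjoint t).mul_const p).mul (h.deriv t)
  refine this.congr_deriv ?_
  simp only [comm, smul_mul_assoc, mul_smul_comm, neg_smul, mul_neg, ← sub_eq_add_neg, ← smul_sub]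
  congr 1
  noncomm_ring

/-- Together with `norm_conj` this moves the time dependence from `a` to the generator: oscillations
of U a U† become commutators of the fixed `a` with evolved generators, whose derivative involves `H`
only through its local commutators. -/
theorem comm_conj (h : IsSchrodinger H U) (t : ℝ) (p a : A) :
    (comm (star (U t) * p * U t) a) = star (U t) * (comm p (U t * a * star (U t))) * U t := by
  have h1 := h.star_mul t
  have e1 : star (U t) * (p * (U t * a * star (U t))) * U t
      = star (U t) * p * U t * a * (star (U t) * U t) := by noncomm_ring
  have e2 : star (U t) * (U t * a * star (U t) * p) * U t
      = (star (U t) * U t) * a * (star (U t) * p * U t) := by noncomm_ring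
  rw [comm, comm, mul_sub, sub_mul, e1, e2, h1, mul_one, one_mul]

end IsSchrodinger

variable {V : Type*}

/-- The total size of the commutators of `a` with the generators at the site `w`. -/
noncomputable def oscillation (P : V → Bool → A) (w : V) (a : A) : ℝ :=
  ∑ b, ‖comm (P w b) a‖

theorem oscillation_nonneg (P : V → Bool → A) (w : V) (a : A) : 0 ≤ oscillation P w a :=
  Finset.sum_nonneg fun _ _ => norm_nonneg _

theorem norm_comm_le_oscillation (P : V → Bool → A) (w : V) (b : Bool) (a : A) :
    ‖comm (P w b) a‖ ≤ oscillation P w a :=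
  Finset.single_le_sum (f := fun b => ‖comm (P w b) a‖) (fun _ _ => norm_nonneg _) (Finset.mem_univ b)

/-- One-site terms `h` and two-site terms `e` along the edges of `G`, of strength at most `K`,
in the presence of local generators `P` of norm at most one. -/
structure IsLocal (P : V → Bool → A) (G : SimpleGraph V) (K : ℝ) (h : V → A) (e : V → V → A) :
    Prop where
  norm_gen_le : ∀ w b, ‖P w b‖ ≤ 1
  norm_site_le : ∀ i, ‖h i‖ ≤ K
  norm_edge_le : ∀ i j, ‖e i j‖ ≤ K
  site_comm_le : ∀ i a, ‖comm (h i) a‖ ≤ K * oscillation P i a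
  edge_comm_le : ∀ i j a, ‖comm (e i j) a‖ ≤ K * (oscillation P i a + oscillation P j a)
  site_comm_gen : ∀ i w b, i ≠ w → (comm (h i) (P w b)) = 0
  edge_comm_gen : ∀ i j w b, i ≠ w → j ≠ w → (comm (e i j) (P w b)) = 0
  edge_eq_zero : ∀ i j, ¬ G.Adj i j → e i j = 0

namespace IsLocal

variable {P : V → Bool → A} {G : SimpleGraph V} {K : ℝ} {h : V → A}
  {e : V → V → A}

/-- Terms at other sites commute with the generator; at `w` each half of the Jacobi identity costs
`2 * K`. -/
theorem norm_site_comm_comm_le [DecidableEq V] (L : IsLocal P G K h e) (i w : V) (b : Bool) (a : A) :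
    ‖comm (comm (h i) (P w b)) a‖ ≤ if i = w then 4 * K * oscillation P w a else 0 := by
  split_ifs with hi
  · subst hi
    have h1 := norm_comm_comm_le (h i) (P i b) a
    have h2 := norm_comm_le_oscillation P i b a
    have h3 := L.site_comm_le i a
    have h4 := L.norm_gen_le i b
    have h5 := L.norm_site_le i
    have hK : 0 ≤ K := (norm_nonneg _).trans h5
    have : 2 * ‖h i‖ * ‖comm (P i b) a‖ ≤ 2 * K * oscillation P i a := by gcongr
    have : 2 * ‖P i b‖ * ‖comm (h i) a‖ ≤ 2 * 1 * (K * oscillation P i a) := by gcongr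
    linarith
  · simp [L.site_comm_gen i w b hi, zero_comm]

/-- An edge matters only at its end points. One indicator per end point makes the bound ready to be
summed over all ordered pairs. -/
theorem norm_edge_comm_comm_le [DecidableRel G.Adj] [DecidableEq V] (L : IsLocal P G K h e) (hK : 0 ≤ K) (i j w : V)
    (b : Bool) (a : A) :
    ‖comm (comm (e i j) (P w b)) a‖ ≤
      (if i = w then if G.Adj w j then 4 * K * (oscillation P w a + oscillation P j a) else 0
        else 0) +
      (if j = w then if G.Adj w i then 4 * K * (oscillation P w a + oscillation P i a) else 0
        else 0) := by
  have ho := fun w => oscillation_nonneg P w a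
  have hpos : ∀ x y, 0 ≤ 4 * K * (oscillation P x a + oscillation P y a) := fun x y =>
    mul_nonneg (by positivity) (add_nonneg (ho x) (ho y))
  by_cases hij : G.Adj i j
  · have h1 := norm_comm_comm_le (e i j) (P w b) a
    have h2 := norm_comm_le_oscillation P w b a
    have h3 := L.edge_comm_le i j a
    have h4 := L.norm_gen_le w b
    have h5 := L.norm_edge_le i j
    have h6 : 2 * ‖e i j‖ * ‖comm (P w b) a‖ ≤ 2 * K * oscillation P w a := by gcongr
    have h7 : 2 * ‖P w b‖ * ‖comm (e i j) a‖ ≤ 2 * 1 * (K * (oscillation P i a + oscillation P j a)) := by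
      gcongr
    have hm := fun w => mul_nonneg hK (ho w)
    by_cases hi : i = w
    · subst hi
      simp only [hij, if_true, hij.ne', if_false]
      nlinarith [hm i, hm j]
    · by_cases hj : j = w
      · subst hj
        simp only [hij.symm, if_true, hi, if_false]
        nlinarith [hm i, hm j]
      · simp [L.edge_comm_gen i j w b hi hj, hi, hj, zero_comm]
  · rw [L.edge_eq_zero i j hij]
    simp only [zero_comm, norm_zero]
    split_ifs <;> first | positivity | (have := hpos w j; have := hpos w i; linarith)

theorem norm_comm_comm_le [Fintype V] [DecidableRel G.Adj] [DecidableEq V] (L : IsLocal P G K h e) (hK : 0 ≤ K) (w : V) (b : Bool)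
    (a : A) :
    ‖comm (comm (∑ i, h i + ∑ i, ∑ j, e i j) (P w b)) a‖ ≤ 4 * K * oscillation P w a +
      ∑ z, if G.Adj w z then 8 * K * (oscillation P w a + oscillation P z a) else 0 := by
  have e1 : (comm (comm (∑ i, h i + ∑ i, ∑ j, e i j) (P w b)) a) =
      ∑ i, (comm (comm (h i) (P w b)) a) + ∑ i, ∑ j, (comm (comm (e i j) (P w b)) a) := by
    simp only [add_comm_left, sum_comm_left]
  rw [e1]
  refine (norm_add_le _ _).trans (add_le_add ?_ ?_)
  · refine (norm_sum_le_of_le _ fun i _ => L.norm_site_comm_comm_le i w b a).trans ?_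
    simp
  · refine (norm_sum_le_of_le _ fun i _ => norm_sum_le_of_le _ fun j _ =>
      L.norm_edge_comm_comm_le hK i j w b a).trans ?_
    simp only [Finset.sum_add_distrib]
    -- The pairs `(w, z)` and `(z, w)` both contribute `4 * K`, hence the factor `8 * K` for each
    -- neighbour `z`.
    rw [Finset.sum_comm (f := fun i j => if i = w then _ else _)]
    simp only [Finset.sum_ite_eq', Finset.mem_univ, if_true]
    rw [← Finset.sum_add_distrib]
    refine Finset.sum_le_sum fun z _ => ?_
    split_ifs <;> linarith

/-- The rate at which a weighted sum of oscillations can grow. -/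
theorem sum_weight_mul_norm_comm_comm_le [Fintype V] [DecidableRel G.Adj] [DecidableEq V] (L : IsLocal P G K h e) (hK : 0 ≤ K)
    {d : ℕ} (hd : ∀ w, G.degree w ≤ d) {q : V → ℝ} (hq : ∀ w, 0 ≤ q w) {l : ℝ}
    (hl : ∀ w z, G.Adj w z → q w ≤ l * q z) (hl0 : 0 ≤ l) (a : A) :
    ∑ w, ∑ b, q w * ‖comm (comm (∑ i, h i + ∑ i, ∑ j, e i j) (P w b)) a‖ ≤
      (8 * K + 16 * K * d * (1 + l)) * ∑ w, q w * oscillation P w a := by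
  have ho := fun w => oscillation_nonneg P w a
  have h1 : ∀ w, ∑ b, q w * ‖comm (comm (∑ i, h i + ∑ i, ∑ j, e i j) (P w b)) a‖ ≤
      -- Summing over the two generators doubles the constants; `hl` then trades the weight of `w`
      -- for that of its neighbour `z`.
      8 * K * (q w * oscillation P w a) +
      16 * K * ∑ z, if G.Adj w z then q w * oscillation P w a + l * (q z * oscillation P z a)
        else 0 := by
    intro w
    calc _ ≤ ∑ b : Bool, q w * (4 * K * oscillation P w a +
          ∑ z, if G.Adj w z then 8 * K * (oscillation P w a + oscillation P z a) else 0) := by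
          gcongr with b
          · exact hq w
          · exact L.norm_comm_comm_le hK w b a
      _ = 8 * K * (q w * oscillation P w a) +
          16 * K * ∑ z, if G.Adj w z then q w * oscillation P w a + q w * oscillation P z a
            else 0 := by
          simp only [Finset.sum_const, Finset.card_univ, Fintype.card_bool, nsmul_eq_mul,
            ← mul_add, ← Finset.sum_filter, ← Finset.mul_sum]
          push_cast
          ring
      _ ≤ _ := by
          gcongr with z
          split_ifs with hz
          · have := mul_le_mul_of_nonneg_right (hl w z hz) (ho z)
            linarith
          · rfl
  refine (Finset.sum_le_sum fun w _ => h1 w).trans ?_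
  have hdeg : ∀ w (c : ℝ), 0 ≤ c → (∑ z, if G.Adj w z then c else 0) ≤ d * c := by
    intro w c hc
    rw [← Finset.sum_filter, Finset.sum_const, nsmul_eq_mul]
    gcongr
    have := hd w
    rwa [← G.card_neighborFinset_eq_degree, G.neighborFinset_eq_filter] at this
  -- After exchanging the sums in the second half, each vertex is charged at most `d` times, once
  -- per neighbour.
  have h2 : (∑ w, ∑ z, if G.Adj w z then q w * oscillation P w a +
      l * (q z * oscillation P z a) else 0) ≤
      d * (1 + l) * ∑ w, q w * oscillation P w a := by
    have e2 : ∀ w z, (if G.Adj w z then q w * oscillation P w a +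
        l * (q z * oscillation P z a) else 0) = (if G.Adj w z then q w * oscillation P w a else 0) +
        if G.Adj z w then l * (q z * oscillation P z a) else 0 := by
      intro w z
      simp only [G.adj_comm z w]
      split_ifs <;> simp
    simp only [e2, Finset.sum_add_distrib]
    rw [Finset.sum_comm (f := fun w z => if G.Adj z w then _ else _)]
    have h3 := Finset.sum_le_sum fun w (_ : w ∈ Finset.univ) =>
      hdeg w (q w * oscillation P w a) (mul_nonneg (hq w) (ho w))
    have h4 := Finset.sum_le_sum fun w (_ : w ∈ Finset.univ) =>
      hdeg w (l * (q w * oscillation P w a)) (mul_nonneg hl0 (mul_nonneg (hq w) (ho w)))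
    refine (add_le_add h3 h4).trans (le_of_eq ?_)
    simp only [← Finset.mul_sum]
    ring
  rw [Finset.sum_add_distrib, ← Finset.mul_sum, ← Finset.mul_sum]
  have := mul_le_mul_of_nonneg_left h2 (show 0 ≤ 16 * K by positivity)
  linarith

end IsLocal

variable [Fintype V] {W HB : ℝ → A}

/-- **Lieb–Robinson bound**: weighted oscillations grow at most exponentially. -/
theorem IsSchrodinger.sum_oscillation_le (hU : IsSchrodinger H U) (P : V → Bool → A) {q : V → ℝ}
    (hq : ∀ w, 0 ≤ q w) {κ T : ℝ}
    (hκ : ∀ s ∈ Set.Icc 0 T, ∀ a, ∑ w, ∑ b, q w * ‖comm (comm (H s) (P w b)) a‖ ≤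
      κ * ∑ w, q w * oscillation P w a) (a : A) {s : ℝ} (hs : s ∈ Set.Icc 0 T) :
    ∑ w, q w * oscillation P w (U s * a * star (U s)) ≤
      (∑ w, q w * oscillation P w (U T * a * star (U T))) * Real.exp (κ * (T - s)) := by
  let f : V × Bool → ℝ → A := fun i s => q i.1 • (comm (star (U s) * P i.1 i.2 * U s) a)
  let f' : V × Bool → ℝ → A := fun i s =>
    q i.1 • (Complex.I • (comm (star (U s) * (comm (H s) (P i.1 i.2)) * U s) a))
  have hf : ∀ i s, HasDerivAt (f i) (f' i s) s := by
    intro i s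
    have h1 := hU.hasDerivAt_conj (P i.1 i.2) s
    have h2 := ((h1.mul_const a).sub (h1.const_mul a)).const_smul (q i.1)
    refine h2.congr_deriv ?_
    simp only [f', comm, smul_mul_assoc, mul_smul_comm, smul_sub]
  have hnf : ∀ s, ∑ i, ‖f i s‖ = ∑ w, q w * oscillation P w (U s * a * star (U s)) := by
    intro s
    simp only [f, Fintype.sum_prod_type, norm_smul, Real.norm_of_nonneg (hq _), oscillation,
      Finset.mul_sum, hU.comm_conj, hU.norm_conj]
  have hnf' : ∀ s, ∑ i, ‖f' i s‖ =
      ∑ w, ∑ b, q w * ‖comm (comm (H s) (P w b)) (U s * a * star (U s))‖ := by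
    intro s
    simp only [f', Fintype.sum_prod_type, norm_smul, Real.norm_of_nonneg (hq _), Complex.norm_I,
      one_mul, hU.comm_conj, hU.norm_conj]
  have key := sum_norm_le_exp_mul_of_sum_norm_deriv_le hf (fun s hs => by
    rw [hnf, hnf']; exact hκ s hs _) hs
  rwa [hnf, hnf] at key

/-- Comparison of the Heisenberg evolutions for two Hamiltonians that differ far away. -/
theorem IsSchrodinger.norm_conj_sub_conj_le (hU : IsSchrodinger H U) (hW : IsSchrodinger HB W)
    (P : V → Bool → A) {q : V → ℝ}
    (hq : ∀ w, 0 ≤ q w) {κ T M : ℝ} (hT : 0 ≤ T) (hκ0 : 0 ≤ κ) (hM : 0 ≤ M)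
    (hκ : ∀ s ∈ Set.Icc 0 T, ∀ a, ∑ w, ∑ b, q w * ‖comm (comm (H s) (P w b)) a‖ ≤
      κ * ∑ w, q w * oscillation P w a)
    (hR : ∀ s ∈ Set.Icc 0 T, ∀ a, ‖comm (H s - HB s) a‖ ≤ M * ∑ w, q w * oscillation P w a) (o : A) :
    ‖star (U T) * o * U T - star (W T) * o * W T‖ ≤
      M * ((∑ w, q w * oscillation P w o) * Real.exp (κ * T)) * T := by
  -- With this choice `U s * a * star (U s)` runs from `a` at time `0` to `o` at time `T`, where its
  -- oscillations are known.
  set a := star (U T) * o * U T with ha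
  have haT : U T * a * star (U T) = o := by
    calc U T * a * star (U T) = (U T * star (U T)) * o * (U T * star (U T)) := by
          rw [ha]; noncomm_ring
      _ = o := by rw [hU.mul_star]; simp
  -- `Q` joins the two Heisenberg operators; in its derivative the two generators combine to `H s -
  -- HB s`.
  let Q : ℝ → A := fun s => star (W s) * (U s * a * star (U s)) * W s
  let Q' : ℝ → A := fun s => -Complex.I •
    (star (W s) * (comm (H s - HB s) (U s * a * star (U s))) * W s)
  have hQ : ∀ s, HasDerivAt Q (Q' s) s := by
    intro s
    have h1 := ((hU.deriv s).mul_const a).mul (hasDerivAt_star_evolution hU.deriv hU.selfAdjoint s)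
    have h2 := ((hasDerivAt_star_evolution hW.deriv hW.selfAdjoint s).mul h1).mul (hW.deriv s)
    refine h2.congr_deriv ?_
    simp only [Q', comm, Pi.mul_apply, smul_mul_assoc, mul_smul_comm, neg_smul, ← smul_neg,
      ← smul_add]
    congr 1
    noncomm_ring
  have hbound : ∀ s ∈ Set.Ico 0 T, ‖Q' s‖ ≤
      M * ((∑ w, q w * oscillation P w o) * Real.exp (κ * T)) := by
    intro s hs
    have hs' := Set.Ico_subset_Icc_self hs
    have h1 := hU.sum_oscillation_le P hq hκ a hs'
    rw [haT] at h1
    rw [norm_smul, norm_neg, Complex.norm_I, one_mul, hW.norm_conj]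
    refine (hR s hs' _).trans (mul_le_mul_of_nonneg_left (h1.trans ?_) hM)
    refine mul_le_mul_of_nonneg_left (Real.exp_le_exp.2 ?_)
      (Finset.sum_nonneg fun w _ => mul_nonneg (hq w) (oscillation_nonneg P w o))
    have := hs.1
    gcongr
    linarith
  have key := norm_image_sub_le_of_norm_deriv_le_segment' (f := Q) (f' := Q')
    (fun s _ => (hQ s).hasDerivWithinAt) hbound T ⟨hT, le_rfl⟩
  have e0 : Q 0 = a := by simp [Q, hU.zero, hW.zero]
  have eT : Q T = star (W T) * o * W T := by simp only [Q, haT]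
  rw [e0, eT, norm_sub_rev, sub_zero] at key
  exact key

end CStar

/-! ### Operators on a subset of the qubits -/

section ExtendOp

variable {ι κ V : Type*} {f : ι → V}

open Classical in
theorem extendOp_apply (f : ι → V) (O : Matrix (ι → Bool) (ι → Bool) ℂ) (x y : V → Bool) :
    extendOp f O x y =
      if ∀ i, i ∉ Set.range f → x i = y i then O (x ∘ f) (y ∘ f) else 0 :=
  rfl

theorem eq_of_comp_eq_of_eq_off_range {x y : V → Bool} (h1 : x ∘ f = y ∘ f)
    (h2 : ∀ i, i ∉ Set.range f → x i = y i) : x = y := by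
  funext i
  by_cases hi : i ∈ Set.range f
  · obtain ⟨j, rfl⟩ := hi
    exact congrFun h1 j
  · exact h2 i hi

theorem extend_comp (hf : f.Injective) (w : ι → Bool) (x : V → Bool) :
    Function.extend f w x ∘ f = w := by
  funext j
  simp [hf.extend_apply]

theorem extend_comp_eq_of_eq_off_range (hf : f.Injective) {x z : V → Bool}
    (h : ∀ i, i ∉ Set.range f → x i = z i) : Function.extend f (z ∘ f) x = z :=
  eq_of_comp_eq_of_eq_off_range (f := f) (extend_comp hf _ _) fun i hi => by
    rw [Function.extend_apply' _ _ _ fun ⟨j, hj⟩ => hi ⟨j, hj⟩, h i hi]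

/-- A string that agrees with `x` off the range of `f` is determined by its restriction along `f`,
which is arbitrary. This turns sums of entries of `extendOp` into sums over the small system. -/
theorem sum_eq_off_range [Fintype ι] [Fintype V] [DecidableEq ι] [DecidableEq V] (hf : f.Injective) {M : Type*} [AddCommMonoid M]
    (x : V → Bool) [hdec : DecidablePred fun z : V → Bool => ∀ i, i ∉ Set.range f → x i = z i]
    (F : (V → Bool) → M) :
    (∑ z, if ∀ i, i ∉ Set.range f → x i = z i then F z else 0) =
      ∑ w, F (Function.extend f w x) := by
  refine (Finset.sum_filter (fun z : V → Bool => ∀ i, i ∉ Set.range f → x i = z i) F).symm.trans ?_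
  refine Finset.sum_bij' (fun z _ => z ∘ f) (fun w _ => Function.extend f w x) ?_ ?_ ?_ ?_ ?_
  · simp
  · intro w _
    rw [Finset.mem_filter]
    refine ⟨Finset.mem_univ _, fun i hi => ?_⟩
    rw [Function.extend_apply' _ _ _ fun ⟨j, hj⟩ => hi ⟨j, hj⟩]
  · intro z hz
    exact extend_comp_eq_of_eq_off_range hf (Finset.mem_filter.1 hz).2
  · intro w _
    exact extend_comp hf w x
  · intro z hz
    rw [extend_comp_eq_of_eq_off_range hf (Finset.mem_filter.1 hz).2]

theorem extendOp_mul [Fintype ι] [Fintype V] [DecidableEq ι] [DecidableEq V] (hf : f.Injective)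
    (O O' : Matrix (ι → Bool) (ι → Bool) ℂ) :
    extendOp f (O * O') = extendOp f O * extendOp f O' := by
  classical
  ext x y
  have h1 : (extendOp f O * extendOp f O') x y =
      ∑ z, if ∀ i, i ∉ Set.range f → x i = z i then O (x ∘ f) (z ∘ f) * extendOp f O' z y else 0 := by
    rw [Matrix.mul_apply]
    refine Finset.sum_congr rfl fun z _ => ?_
    rw [extendOp_apply]
    split_ifs <;> simp
  have h3 : ∀ w : ι → Bool, (∀ i, i ∉ Set.range f → Function.extend f w x i = y i) ↔
      ∀ i, i ∉ Set.range f → x i = y i := fun w =>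
    forall₂_congr fun i hi => by
      rw [Function.extend_apply' _ _ _ fun ⟨j, hj⟩ => hi ⟨j, hj⟩]
  rw [h1, sum_eq_off_range (hdec := _) hf]
  simp only [extendOp_apply, extend_comp hf, h3]
  split_ifs
  · rw [Matrix.mul_apply]
  · simp

theorem extendOp_one [DecidableEq (ι → Bool)] [DecidableEq (V → Bool)] :
    extendOp f 1 = 1 := by
  classical
  ext x y
  rw [extendOp_apply, Matrix.one_apply, Matrix.one_apply]
  by_cases h : x = y
  · simp [h]
  · simp only [h, if_false]
    split_ifs with h1 h2
    · exact absurd (eq_of_comp_eq_of_eq_off_range h2 h1) h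
    · rfl
    · rfl

theorem extendOp_conjTranspose (O : Matrix (ι → Bool) (ι → Bool) ℂ) :
    extendOp f O.conjTranspose = (extendOp f O).conjTranspose := by
  classical
  ext x y
  have : (∀ i, i ∉ Set.range f → x i = y i) ↔ ∀ i, i ∉ Set.range f → y i = x i :=
    forall₂_congr fun i _ => eq_comm
  rw [Matrix.conjTranspose_apply, extendOp_apply, extendOp_apply, if_congr this rfl rfl]
  split_ifs <;> simp

theorem extendOp_extendOp {g : κ → ι} (hf : f.Injective) (O : Matrix (κ → Bool) (κ → Bool) ℂ) :
    extendOp f (extendOp g O) = extendOp (f ∘ g) O := by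
  classical
  ext x y
  have : (∀ i, i ∉ Set.range (f ∘ g) → x i = y i) ↔ (∀ i, i ∉ Set.range f → x i = y i) ∧
      ∀ j, j ∉ Set.range g → (x ∘ f) j = (y ∘ f) j := by
    constructor
    · refine fun h => ⟨fun i hi => h i fun ⟨k, hk⟩ => hi ⟨g k, hk⟩, fun j hj => h (f j) ?_⟩
      rintro ⟨k, hk⟩
      exact hj ⟨k, hf hk⟩
    · rintro ⟨h1, h2⟩ i hi
      by_cases h : i ∈ Set.range f
      · obtain ⟨j, rfl⟩ := h
        refine h2 j ?_
        rintro ⟨k, rfl⟩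
        exact hi ⟨k, rfl⟩
      · exact h1 i h
  rw [extendOp_apply, extendOp_apply, extendOp_apply, if_congr this rfl rfl, ite_and]
  rfl

/-- The extension `O ↦ O ⊗ I` as a homomorphism of star algebras. -/
noncomputable def extendHom [Fintype ι] [Fintype V] [DecidableEq ι] [DecidableEq V]
    (hf : f.Injective) :
    Matrix (ι → Bool) (ι → Bool) ℂ →⋆ₐ[ℂ] Matrix (V → Bool) (V → Bool) ℂ where
  toFun := extendOp f
  map_one' := extendOp_one
  map_mul' := extendOp_mul hf
  map_zero' := by ext x y; simp [extendOp_apply]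
  map_add' O O' := by ext x y; simp only [extendOp_apply, Matrix.add_apply]; split_ifs <;> simp
  commutes' c := by
    ext x y
    have := congrFun (congrFun (extendOp_one (f := f)) x) y
    simp only [Algebra.algebraMap_eq_smul_one, extendOp_apply, Matrix.smul_apply, ← this]
    split_ifs <;> simp
  map_star' := extendOp_conjTranspose

theorem extendHom_apply [Fintype ι] [Fintype V] [DecidableEq ι] [DecidableEq V]
    (hf : f.Injective) (O : Matrix (ι → Bool) (ι → Bool) ℂ) : extendHom hf O = extendOp f O :=
  rfl

/-- Homomorphisms of C*-algebras are contractive. -/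
theorem norm_extendOp_le [Fintype ι] [Fintype V] [DecidableEq ι] [DecidableEq V]
    (hf : f.Injective) (O : Matrix (ι → Bool) (ι → Bool) ℂ) : ‖extendOp f O‖ ≤ ‖O‖ :=
  NonUnitalStarAlgHom.norm_apply_le (extendHom hf) O

theorem extendOp_diagonal [DecidableEq (ι → Bool)] [DecidableEq (V → Bool)] (φ : (ι → Bool) → ℂ) :
    extendOp f (Matrix.diagonal φ) = Matrix.diagonal fun x => φ (x ∘ f) := by
  classical
  ext x y
  rw [extendOp_apply, Matrix.diagonal_apply, Matrix.diagonal_apply]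
  by_cases h : x = y
  · simp [h]
  · simp only [h, if_false]
    split_ifs with h1 h2
    · exact absurd (eq_of_comp_eq_of_eq_off_range h2 h1) h
    · rfl
    · rfl

end ExtendOp

/-! ### Local terms of the annealing Hamiltonian -/

section LocalTerms

/-- The bit string with the bit `i` flipped. -/
def flipBit {V : Type*} [DecidableEq V] (i : V) (x : V → Bool) : V → Bool :=
  Function.update x i (!x i)

theorem flipBit_flipBit {V : Type*} [DecidableEq V] (i : V) (x : V → Bool) :
    flipBit i (flipBit i x) = x := by
  simp [flipBit]

theorem eq_flipBit_comm {V : Type*} [DecidableEq V] {i : V} {x y : V → Bool} :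
    x = flipBit i y ↔ y = flipBit i x :=
  ⟨fun h => by rw [h, flipBit_flipBit], fun h => by rw [h, flipBit_flipBit]⟩

theorem flipBit_of_ne {V : Type*} [DecidableEq V] {i j : V} (h : j ≠ i) (x : V → Bool) :
    flipBit i x j = x j := by
  simp [flipBit, h]

theorem flipBit_flipBit_comm {V : Type*} [DecidableEq V] {i j : V} (h : i ≠ j) (x : V → Bool) :
    flipBit i (flipBit j x) = flipBit j (flipBit i x) := by
  simp only [flipBit, Function.update_of_ne h, Function.update_of_ne h.symm]
  exact Function.update_comm h.symm _ _ _

theorem flipBit_comp {ι V : Type*} [DecidableEq ι] [DecidableEq V] {f : ι → V} (hf : f.Injective)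
    (i : ι) (x : V → Bool) : flipBit (f i) x ∘ f = flipBit i (x ∘ f) := by
  funext j
  by_cases h : j = i
  · subst h; simp [flipBit]
  · simp [flipBit, h, hf.ne h]

theorem flipBit_comp_of_notMem {ι V : Type*} [DecidableEq V] {f : ι → V} {w : V}
    (hw : w ∉ Set.range f) (x : V → Bool) : flipBit w x ∘ f = x ∘ f := by
  funext j
  exact flipBit_of_ne (fun h => hw ⟨j, h⟩) x

variable {V : Type*} [Fintype V] [LinearOrder V]

theorem bitFlip_apply (i : V) (x y : V → Bool) :
    bitFlip i x y = if x = flipBit i y then 1 else 0 :=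
  rfl

theorem bitFlip_mul_apply (i : V) (M : Matrix (V → Bool) (V → Bool) ℂ) (x y : V → Bool) :
    (bitFlip i * M) x y = M (flipBit i x) y := by
  simp only [Matrix.mul_apply, bitFlip_apply, eq_flipBit_comm (x := x), ite_mul, one_mul, zero_mul,
    Finset.sum_ite_eq', Finset.mem_univ, if_true]

theorem mul_bitFlip_apply (i : V) (M : Matrix (V → Bool) (V → Bool) ℂ) (x y : V → Bool) :
    (M * bitFlip i) x y = M x (flipBit i y) := by
  simp only [Matrix.mul_apply, bitFlip_apply, mul_ite, mul_one, mul_zero,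
    Finset.sum_ite_eq', Finset.mem_univ, if_true]

theorem commute_bitFlip {i : V} {M : Matrix (V → Bool) (V → Bool) ℂ}
    (h : ∀ x y, M (flipBit i x) y = M x (flipBit i y)) : Commute (bitFlip i) M := by
  ext x y
  rw [bitFlip_mul_apply, mul_bitFlip_apply, h]

theorem commute_bitFlip_diagonal {i : V} {φ : (V → Bool) → ℂ} (h : ∀ x, φ (flipBit i x) = φ x) :
    Commute (bitFlip i) (Matrix.diagonal φ) := by
  refine commute_bitFlip fun x y => ?_
  simp only [Matrix.diagonal_apply, h, eq_flipBit_comm (x := x), eq_comm (b := y)]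

theorem commute_bitFlip_bitFlip {i j : V} (h : i ≠ j) :
    Commute (bitFlip i : Matrix (V → Bool) (V → Bool) ℂ) (bitFlip j) := by
  refine commute_bitFlip fun x y => ?_
  rw [bitFlip_apply, bitFlip_apply]
  refine if_congr ?_ rfl rfl
  rw [← flipBit_flipBit_comm h, eq_flipBit_comm (x := x), eq_comm]

theorem commute_diagonal (φ ψ : (V → Bool) → ℂ) :
    Commute (Matrix.diagonal φ) (Matrix.diagonal ψ) := by
  simp only [Commute, SemiconjBy, Matrix.diagonal_mul_diagonal, mul_comm]

theorem isSelfAdjoint_bitFlip (i : V) :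
    IsSelfAdjoint (bitFlip i : Matrix (V → Bool) (V → Bool) ℂ) := by
  ext x y
  simp only [Matrix.star_apply, bitFlip_apply, eq_flipBit_comm (x := y)]
  split_ifs <;> simp

theorem norm_bitFlip_le (i : V) : ‖(bitFlip i : Matrix (V → Bool) (V → Bool) ℂ)‖ ≤ 1 := by
  have h : bitFlip i * bitFlip i = (1 : Matrix (V → Bool) (V → Bool) ℂ) := by
    ext x y
    rw [bitFlip_mul_apply, bitFlip_apply, Matrix.one_apply]
    refine if_congr ?_ rfl rfl
    rw [eq_flipBit_comm, flipBit_flipBit, eq_comm]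
  have hs := (isSelfAdjoint_bitFlip i).star_eq
  exact (CStarRing.norm_of_mem_unitary (Unitary.mem_iff.2 ⟨by rw [hs, h], by rw [hs, h]⟩)).le

theorem isSelfAdjoint_diagonal_ofReal {V : Type*} [DecidableEq (V → Bool)] (φ : (V → Bool) → ℝ) :
    IsSelfAdjoint (Matrix.diagonal fun x => (φ x : ℂ)) := by
  rw [IsSelfAdjoint, Matrix.star_eq_conjTranspose, Matrix.diagonal_conjTranspose]
  congr 1
  funext x
  simp

theorem norm_diagonal_ofReal_le {φ : (V → Bool) → ℝ} {J : ℝ} (hJ : 0 ≤ J) (h : ∀ x, |φ x| ≤ J) :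
    ‖(Matrix.diagonal fun x => (φ x : ℂ))‖ ≤ J := by
  rw [Matrix.l2_opNorm_diagonal]
  exact (pi_norm_le_iff_of_nonneg hJ).2 fun x => by simpa using h x

/-- The projection on the basis states whose bit `i` is one. -/
def occupation (i : V) : Matrix (V → Bool) (V → Bool) ℂ :=
  Matrix.diagonal fun x => (((if x i then 1 else 0 : ℝ)) : ℂ)

/-- The bit flip and the occupation number generate the operators on the qubit `i`. -/
def generator (i : V) (b : Bool) : Matrix (V → Bool) (V → Bool) ℂ :=
  if b then bitFlip i else occupation i

theorem norm_occupation_le (i : V) : ‖occupation i‖ ≤ 1 :=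
  norm_diagonal_ofReal_le zero_le_one fun x => by split_ifs <;> simp

theorem norm_generator_le (i : V) (b : Bool) : ‖generator i b‖ ≤ 1 := by
  cases b
  · exact norm_occupation_le i
  · exact norm_bitFlip_le i

theorem commute_generator {w : V} {M : Matrix (V → Bool) (V → Bool) ℂ}
    (h1 : Commute M (bitFlip w)) (h2 : Commute M (occupation w)) (b : Bool) :
    Commute M (generator w b) := by
  cases b
  · exact h2
  · exact h1

/-- The entries of O ⊗ I vanish unless row and column agree at `w`, and otherwise ignore that bit.
The first fact gives commutation with the occupation number, both together commutation with the
flip. -/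
theorem commute_extendOp_generator {ι : Type*} {f : ι → V} {w : V} (hw : w ∉ Set.range f)
    (O : Matrix (ι → Bool) (ι → Bool) ℂ) (b : Bool) : Commute (extendOp f O) (generator w b) := by
  refine commute_generator (Commute.symm (commute_bitFlip fun x y => ?_)) ?_ b
  · have : (∀ i, i ∉ Set.range f → flipBit w x i = y i) ↔
        ∀ i, i ∉ Set.range f → x i = flipBit w y i := by
      refine forall₂_congr fun i _ => ?_
      by_cases hi : i = w
      · subst hi
        simp [flipBit, Bool.not_eq_eq_eq_not]
      · rw [flipBit_of_ne hi, flipBit_of_ne hi]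
    simp only [extendOp_apply, flipBit_comp_of_notMem hw]
    split_ifs with h1 h2 h2
    · rfl
    · exact absurd (this.1 h1) h2
    · exact absurd (this.2 h2) h1
    · rfl
  · ext x y
    rw [occupation, Matrix.mul_diagonal, Matrix.diagonal_mul, extendOp_apply]
    by_cases h : ∀ i, i ∉ Set.range f → x i = y i
    · rw [h w hw, mul_comm]
    · rw [if_neg h, zero_mul, mul_zero]

theorem extendOp_bitFlip {ι : Type*} [Fintype ι] [LinearOrder ι] {f : ι → V} (hf : f.Injective)
    (i : ι) : extendOp f (bitFlip i) = bitFlip (f i) := by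
  classical
  ext x y
  rw [extendOp_apply, bitFlip_apply, bitFlip_apply, ← flipBit_comp hf]
  by_cases h : x = flipBit (f i) y
  · subst h
    rw [if_pos fun j hj => flipBit_of_ne (fun h => hj ⟨i, h.symm⟩) y]
    simp
  · rw [if_neg h]
    split_ifs with h1 h2
    · refine absurd (eq_of_comp_eq_of_eq_off_range h2 fun j hj => ?_) h
      rw [flipBit_of_ne (fun h => hj ⟨i, h.symm⟩) y, h1 j hj]
    · rfl
    · rfl

end LocalTerms

/-! ### Site and edge terms of the annealing Hamiltonian, and unitarity of the evolution -/

section Hamiltonian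

variable {V : Type*} [Fintype V] [LinearOrder V]

/-- The cost of the vertex `i` as an operator. -/
noncomputable def siteCost (v : Bool → ℝ) (i : V) : Matrix (V → Bool) (V → Bool) ℂ :=
  Matrix.diagonal fun x => (v (x i) : ℂ)

/-- The cost of the pair `⟨i, j⟩` as an operator. -/
noncomputable def edgeCost (u : Bool → Bool → ℝ) (i j : V) : Matrix (V → Bool) (V → Bool) ℂ :=
  Matrix.diagonal fun x => (u (x i) (x j) : ℂ)

/-- The part of the Hamiltonian at the vertex `i`, at the fraction `c` of the running time. -/
noncomputable def siteTerm (v : Bool → ℝ) (c : ℝ) (i : V) : Matrix (V → Bool) (V → Bool) ℂ :=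
  -((1 - c) • bitFlip i + c • siteCost v i)

/-- The part of the Hamiltonian at the edge `⟨i, j⟩`, at the fraction `c` of the running time. -/
noncomputable def edgeTerm (u : Bool → Bool → ℝ) (c : ℝ) (i j : V) :
    Matrix (V → Bool) (V → Bool) ℂ :=
  -(c • edgeCost u i j)

theorem targetHamiltonian_eq_sum (v : Bool → ℝ) (u : Bool → Bool → ℝ) (G : SimpleGraph V)
    [DecidableRel fun i j => i < j ∧ G.Adj i j] :
    targetHamiltonian v u G =
      -(∑ i, siteCost v i + ∑ i, ∑ j, if i < j ∧ G.Adj i j then edgeCost u i j else 0) := by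
  ext x y
  by_cases h : x = y
  · subst h
    simp only [targetHamiltonian, cost, siteCost, edgeCost, Matrix.neg_apply, Matrix.add_apply,
      Matrix.sum_apply, Matrix.diagonal_apply_eq, Complex.ofReal_add, Complex.ofReal_sum]
    congr 2
    refine Finset.sum_congr rfl fun i _ => Finset.sum_congr rfl fun j _ => ?_
    split_ifs <;> simp
  · simp only [targetHamiltonian, siteCost, edgeCost, Matrix.neg_apply, Matrix.add_apply,
      Matrix.sum_apply, Matrix.diagonal_apply_ne _ h]
    rw [Finset.sum_eq_zero fun i _ => Finset.sum_eq_zero fun j _ => ?_]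
    · simp
    · split_ifs
      · exact Matrix.diagonal_apply_ne _ h
      · rfl

theorem hamiltonian_eq_sum (v : Bool → ℝ) (u : Bool → Bool → ℝ) (G : SimpleGraph V)
    [DecidableRel fun i j => i < j ∧ G.Adj i j] (T t : ℝ) :
    hamiltonian v u G T t = ∑ i, siteTerm v (t / T) i +
      ∑ i, ∑ j, if i < j ∧ G.Adj i j then edgeTerm u (t / T) i j else 0 := by
  have h : ∀ i j, (if i < j ∧ G.Adj i j then edgeTerm u (t / T) i j else 0) =
      -((t / T) • if i < j ∧ G.Adj i j then edgeCost u i j else 0) := by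
    intro i j
    split_ifs <;> simp [edgeTerm]
  simp only [h, hamiltonian, targetHamiltonian_eq_sum, initialHamiltonian, siteTerm,
    Finset.sum_neg_distrib, Finset.sum_add_distrib, ← Finset.smul_sum]
  module

theorem isSelfAdjoint_hamiltonian (v : Bool → ℝ) (u : Bool → Bool → ℝ) (G : SimpleGraph V)
    (T t : ℝ) : IsSelfAdjoint (hamiltonian v u G T t) := by
  have h0 : IsSelfAdjoint (initialHamiltonian V) :=
    (isSelfAdjoint_sum _ fun i _ => isSelfAdjoint_bitFlip i).neg
  have h1 : IsSelfAdjoint (targetHamiltonian v u G) := by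
    simpa [targetHamiltonian] using isSelfAdjoint_diagonal_ofReal fun x => -cost v u G x
  exact (IsSelfAdjoint.smul (IsSelfAdjoint.all _) h0).add (IsSelfAdjoint.smul (IsSelfAdjoint.all _) h1)

theorem isSchrodinger_evolution (v : Bool → ℝ) (u : Bool → Bool → ℝ) (G : SimpleGraph V) (T : ℝ) :
    IsSchrodinger (hamiltonian v u G T) (evolution v u G T) where
  zero := (evolution_spec v u G T).1
  deriv := (evolution_spec v u G T).2
  selfAdjoint := isSelfAdjoint_hamiltonian v u G T
  unitary t := by
    have h := star_mul_evolution (evolution_spec v u G T).1 (evolution_spec v u G T).2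
      (isSelfAdjoint_hamiltonian v u G T) t
    -- For square matrices a left inverse is a right inverse.
    exact Unitary.mem_iff.2 ⟨h, mul_eq_one_comm.1 h⟩

/-- Applied to O ↦ O ⊗ I, this lets the annealing of the ball run on the qubits of the whole graph.
The homomorphism is contractive, hence continuous, and so commutes with differentiation. -/
theorem IsSchrodinger.map {A B : Type*} [CStarAlgebra A] [CStarAlgebra B] {H U : ℝ → A}
    (h : IsSchrodinger H U) (φ : A →⋆ₐ[ℂ] B) :
    IsSchrodinger (fun t => φ (H t)) (fun t => φ (U t)) where
  zero := by simp [h.zero]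
  deriv t := by
    let ψ : A →L[ℝ] B := (φ.toAlgHom.toLinearMap.restrictScalars ℝ).mkContinuous 1 fun a => by
      simpa using NonUnitalStarAlgHom.norm_apply_le φ a
    have := ψ.hasFDerivAt.comp_hasDerivAt t (h.deriv t)
    refine this.congr_deriv ?_
    show φ _ = _
    simp
  selfAdjoint t := (h.selfAdjoint t).map φ
  unitary t := by
    refine Unitary.mem_iff.2 ⟨?_, ?_⟩
    · rw [← map_star, ← map_mul, h.star_mul, map_one]
    · rw [← map_star, ← map_mul, h.mul_star, map_one]

/-! ### Locality of the terms -/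

/-- A function of one bit is affine in that bit, and the constant part drops out of commutators. -/
theorem siteCost_eq {V : Type*} [Fintype V] (v : Bool → ℝ) (i : V) :
    siteCost v i = ((v false : ℝ) : ℂ) • (1 : Matrix (V → Bool) (V → Bool) ℂ) +
      ((v true - v false : ℝ) : ℂ) • occupation i := by
  ext x y
  by_cases h : x = y
  · subst h
    cases hx : x i <;> simp [siteCost, occupation, hx]
  · simp [siteCost, occupation, h]

/-- Interpolation of a function of two bits by a polynomial of degree one in each, which expresses
it through the generators. -/
theorem edgeCost_eq (u : Bool → Bool → ℝ) (i j : V) :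
    edgeCost u i j = ((u false false : ℝ) : ℂ) • (1 : Matrix (V → Bool) (V → Bool) ℂ) +
      (((u true false - u false false : ℝ) : ℂ) • occupation i +
      (((u false true - u false false : ℝ) : ℂ) • occupation j +
      ((u true true - u true false - u false true + u false false : ℝ) : ℂ) •
        (occupation i * occupation j))) := by
  ext x y
  by_cases h : x = y
  · subst h
    cases hx : x i <;> cases hy : x j <;> simp [edgeCost, occupation, hx, hy]
  · simp [edgeCost, occupation, h]

theorem comm_one_left {A : Type*} [CStarAlgebra A] (a : A) : comm 1 a = 0 := by
  simp [comm]

theorem norm_comm_occupation_le (i : V) (a : Matrix (V → Bool) (V → Bool) ℂ) :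
    ‖comm (occupation i) a‖ ≤ oscillation generator i a :=
  norm_comm_le_oscillation generator i false a

theorem norm_comm_bitFlip_le (i : V) (a : Matrix (V → Bool) (V → Bool) ℂ) :
    ‖comm (bitFlip i) a‖ ≤ oscillation generator i a :=
  norm_comm_le_oscillation generator i true a

theorem norm_comm_siteCost_le {v : Bool → ℝ} {J : ℝ} (hv : ∀ a, |v a| ≤ J) (i : V)
    (a : Matrix (V → Bool) (V → Bool) ℂ) :
    ‖comm (siteCost v i) a‖ ≤ 2 * J * oscillation generator i a := by
  rw [siteCost_eq, add_comm_left, smul_comm_left, smul_comm_left, comm_one_left, smul_zero,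
    zero_add, norm_smul, Complex.norm_real, Real.norm_eq_abs]
  have h1 : |v true - v false| ≤ 2 * J := by
    linarith [abs_sub (v true) (v false), hv true, hv false]
  have h2 := norm_comm_occupation_le i a
  exact mul_le_mul h1 h2 (norm_nonneg _) ((abs_nonneg _).trans h1)

/-- The coefficients of the single occupations are at most `2 * J`, that of the product at most `4 *
J`, and the Leibniz rule handles the product; together they give `6 * J`. -/
theorem norm_comm_edgeCost_le {u : Bool → Bool → ℝ} {J : ℝ} (hu : ∀ a b, |u a b| ≤ J) (i j : V)
    (a : Matrix (V → Bool) (V → Bool) ℂ) :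
    ‖comm (edgeCost u i j) a‖ ≤
      6 * J * (oscillation generator i a + oscillation generator j a) := by
  have key : ∀ (c C : ℝ) (b : Matrix (V → Bool) (V → Bool) ℂ) (o : ℝ), |c| ≤ C → ‖comm b a‖ ≤ o →
      ‖comm ((c : ℂ) • b) a‖ ≤ C * o := by
    intro c C b o hc hb
    rw [smul_comm_left, norm_smul, Complex.norm_real, Real.norm_eq_abs]
    exact mul_le_mul hc hb (norm_nonneg _) ((abs_nonneg _).trans hc)
  have b1 := key (u true false - u false false) (2 * J) _ _
    (by linarith [abs_sub (u true false) (u false false), hu true false, hu false false])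
    (norm_comm_occupation_le i a)
  have b2 := key (u false true - u false false) (2 * J) _ _
    (by linarith [abs_sub (u false true) (u false false), hu false true, hu false false])
    (norm_comm_occupation_le j a)
  have b3 := key (u true true - u true false - u false true + u false false) (4 * J)
    (occupation i * occupation j) (oscillation generator i a + oscillation generator j a) (by
      have := hu true true
      have := hu true false
      have := hu false true
      have := hu false false
      simp only [abs_le] at *
      constructor <;> linarith) (by
      refine (norm_comm_mul_le _ _ _).trans ?_
      rw [add_comm]
      exact add_le_add
        ((mul_le_of_le_one_right (norm_nonneg _) (norm_occupation_le j)).trans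
          (norm_comm_occupation_le i a))
        ((mul_le_of_le_one_left (norm_nonneg _) (norm_occupation_le i)).trans
          (norm_comm_occupation_le j a)))
  rw [edgeCost_eq, add_comm_left, add_comm_left, add_comm_left, smul_comm_left, comm_one_left,
    smul_zero, zero_add]
  refine (norm_add_le _ _).trans ((add_le_add b1 ((norm_add_le _ _).trans
    (add_le_add b2 b3))).trans
    (le_of_eq ?_))
  ring

theorem comm_eq_zero_of_commute {A : Type*} [CStarAlgebra A] {a b : A} (h : Commute a b) :
    comm a b = 0 :=
  sub_eq_zero.2 h

theorem commute_diagonal_generator {w : V} {φ : (V → Bool) → ℂ} (h : ∀ x, φ (flipBit w x) = φ x)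
    (b : Bool) : Commute (Matrix.diagonal φ) (generator w b) :=
  commute_generator (commute_bitFlip_diagonal h).symm (commute_diagonal _ _) b

theorem commute_bitFlip_generator {i w : V} (h : i ≠ w) (b : Bool) :
    Commute (bitFlip i) (generator w b) :=
  commute_generator (commute_bitFlip_bitFlip h)
    (commute_bitFlip_diagonal fun x => by rw [flipBit_of_ne h.symm]) b

theorem comm_neg_real_smul {A : Type*} [CStarAlgebra A] (c : ℝ) (b a : A) :
    comm (-(c • b)) a = -(c • comm b a) := by
  simp only [comm, neg_mul, mul_neg, smul_mul_assoc, mul_smul_comm, smul_sub]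
  abel

theorem siteTerm_eq (v : Bool → ℝ) (c : ℝ) (i : V) :
    siteTerm v c i = -((1 - c) • bitFlip i) + -(c • siteCost v i) := by
  rw [siteTerm, neg_add]

/-- The terms of the annealing Hamiltonian are local. -/
theorem isLocal_terms {v : Bool → ℝ} {u : Bool → Bool → ℝ} {J : ℝ} (hv : ∀ a, |v a| ≤ J)
    (hu : ∀ a b, |u a b| ≤ J) (G : SimpleGraph V) (p : V → V → Prop) [DecidableRel p]
    (hp : ∀ i j, p i j → G.Adj i j) {c : ℝ} (hc : c ∈ Set.Icc (0 : ℝ) 1) :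
    IsLocal generator G (1 + 6 * J) (siteTerm v c)
      (fun i j => if p i j then edgeTerm u c i j else 0) := by
  have hJ : 0 ≤ J := (abs_nonneg _).trans (hv false)
  -- For `c` in the unit interval both coefficients are nonnegative with sum one, so `1` from the
  -- bit flip and at most `6 * J` from the costs fit into `1 + 6 * J`.
  have hc0 := hc.1
  have hc1 : 0 ≤ 1 - c := sub_nonneg.2 hc.2
  have hns : ∀ i : V, ‖siteCost v i‖ ≤ J := fun i =>
    norm_diagonal_ofReal_le hJ fun x => hv _
  have hne : ∀ i j : V, ‖edgeCost u i j‖ ≤ J := fun i j =>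
    norm_diagonal_ofReal_le hJ fun x => hu _ _
  refine ⟨norm_generator_le, fun i => ?_, fun i j => ?_, fun i a => ?_, fun i j a => ?_,
    fun i w b hi => ?_, fun i j w b hi hj => ?_, fun i j hij => if_neg fun h => hij (hp i j h)⟩
  · rw [siteTerm_eq]
    refine (norm_add_le _ _).trans ?_
    rw [norm_neg, norm_neg, norm_smul, norm_smul, Real.norm_of_nonneg hc0, Real.norm_of_nonneg hc1]
    have h1 := mul_le_mul_of_nonneg_left (norm_bitFlip_le i) hc1
    have h2 := mul_le_mul_of_nonneg_left (hns i) hc0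
    nlinarith [mul_nonneg hc1 hJ]
  · split_ifs
    · rw [edgeTerm, norm_neg, norm_smul, Real.norm_of_nonneg hc0]
      have h2 := mul_le_mul_of_nonneg_left (hne i j) hc0
      nlinarith [mul_nonneg hc1 hJ]
    · rw [norm_zero]; positivity
  · rw [siteTerm_eq, add_comm_left, comm_neg_real_smul, comm_neg_real_smul]
    refine (norm_add_le _ _).trans ?_
    rw [norm_neg, norm_neg, norm_smul, norm_smul, Real.norm_of_nonneg hc0, Real.norm_of_nonneg hc1]
    have h1 := mul_le_mul_of_nonneg_left (norm_comm_bitFlip_le i a) hc1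
    have h2 := mul_le_mul_of_nonneg_left (norm_comm_siteCost_le hv i a) hc0
    have ho := oscillation_nonneg generator i a
    have := mul_nonneg hJ ho
    nlinarith [mul_nonneg hc1 this, mul_nonneg hc0 ho]
  · have ho := add_nonneg (oscillation_nonneg generator i a) (oscillation_nonneg generator j a)
    split_ifs
    · rw [edgeTerm, comm_neg_real_smul, norm_neg, norm_smul, Real.norm_of_nonneg hc0]
      have h2 := mul_le_mul_of_nonneg_left (norm_comm_edgeCost_le hu i j a) hc0
      have := mul_nonneg hJ ho
      nlinarith [mul_nonneg hc1 this, mul_nonneg hc0 ho]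
    · rw [zero_comm, norm_zero]; positivity
  · rw [siteTerm]
    refine comm_eq_zero_of_commute (Commute.neg_left (Commute.add_left ?_ ?_))
    · exact (commute_bitFlip_generator hi b).smul_left _
    · exact (commute_diagonal_generator (fun x => by rw [flipBit_of_ne hi]) b).smul_left _
  · split_ifs
    · refine comm_eq_zero_of_commute (Commute.neg_left ?_)
      exact (commute_diagonal_generator
        (fun x => by rw [flipBit_of_ne hi, flipBit_of_ne hj]) b).smul_left _
    · exact zero_comm _

end Hamiltonian

/-! ### The Hamiltonian of a subgraph -/

section Subgraph

variable {V : Type*} [Fintype V] [LinearOrder V]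

theorem extendOp_neg {ι V : Type*} (f : ι → V) (O : Matrix (ι → Bool) (ι → Bool) ℂ) :
    extendOp f (-O) = -extendOp f O := by
  ext x y
  simp only [extendOp_apply, Matrix.neg_apply]
  split_ifs <;> simp

theorem extendOp_real_smul {ι V : Type*} (f : ι → V) (c : ℝ) (O : Matrix (ι → Bool) (ι → Bool) ℂ) :
    extendOp f (c • O) = c • extendOp f O := by
  ext x y
  simp only [extendOp_apply, Matrix.smul_apply]
  split_ifs <;> simp

open Classical in
theorem sum_subtype_eq_sum_ite {V : Type*} [Fintype V] {M : Type*} [AddCommMonoid M] (S : Set V) [Fintype S] (F : V → M) :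
    ∑ i : S, F i = ∑ i, if i ∈ S then F i else 0 := by
  rw [← Finset.sum_filter]
  exact (Finset.sum_subtype _ (by simp) F).symm

theorem extendOp_siteTerm {ι : Type*} [Fintype ι] [LinearOrder ι] {f : ι → V} (hf : f.Injective)
    (v : Bool → ℝ) (c : ℝ) (i : ι) : extendOp f (siteTerm v c i) = siteTerm v c (f i) := by
  have h := map_add (extendHom hf) ((1 - c) • bitFlip i) (c • siteCost v i)
  simp only [extendHom_apply] at h
  rw [siteTerm, siteTerm, extendOp_neg, h, extendOp_real_smul, extendOp_real_smul,
    extendOp_bitFlip hf, siteCost, extendOp_diagonal]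
  rfl

theorem extendOp_edgeTerm {ι V : Type*} [Fintype V] [Fintype ι] [LinearOrder ι] {f : ι → V}
    (u : Bool → Bool → ℝ) (c : ℝ) (i j : ι) :
    extendOp f (edgeTerm u c i j) = edgeTerm u c (f i) (f j) := by
  rw [edgeTerm, edgeTerm, extendOp_neg, extendOp_real_smul, edgeCost, extendOp_diagonal]
  rfl

open Classical in
-- Written over all of `V`, the Hamiltonian of the subgraph can be subtracted term by term from that
-- of `G`. The subgraph inherits the order, so its edges keep their orientation.
theorem extendOp_hamiltonian_coe (v : Bool → ℝ) (u : Bool → Bool → ℝ) {G : SimpleGraph V}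
    (Y : G.Subgraph) (T t : ℝ) :
    extendOp Subtype.val (hamiltonian v u Y.coe T t) =
      (∑ i, if i ∈ Y.verts then siteTerm v (t / T) i else 0) +
      ∑ i, ∑ j, if i < j ∧ Y.Adj i j then edgeTerm u (t / T) i j else 0 := by
  have hf : Function.Injective (Subtype.val : Y.verts → V) := Subtype.val_injective
  have h0 : extendOp (Subtype.val : Y.verts → V) 0 = 0 := map_zero (extendHom hf)
  rw [hamiltonian_eq_sum, ← extendHom_apply hf, map_add, map_sum, map_sum]
  simp only [map_sum]
  simp only [extendHom_apply, extendOp_siteTerm hf, apply_ite (extendOp _), extendOp_edgeTerm, h0,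
    SimpleGraph.Subgraph.coe_adj, Subtype.coe_lt_coe.symm]
  rw [sum_subtype_eq_sum_ite Y.verts fun i => siteTerm v (t / T) i]
  congr 1
  have h1 : ∀ i : Y.verts, (∑ j : Y.verts, if (i : V) < j ∧ Y.Adj i j then
      edgeTerm u (t / T) (i : V) (j : V) else 0) =
      ∑ j : V, if (i : V) < j ∧ Y.Adj i j then edgeTerm u (t / T) (i : V) j else 0 := by
    intro i
    rw [sum_subtype_eq_sum_ite Y.verts fun j => if (i : V) < j ∧ Y.Adj i j then
      edgeTerm u (t / T) (i : V) j else 0]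
    refine Finset.sum_congr rfl fun j _ => ?_
    by_cases hj : j ∈ Y.verts
    · rw [if_pos hj]
    · rw [if_neg hj, if_neg fun h => hj (Y.edge_vert h.2.symm)]
  rw [Finset.sum_congr rfl fun i _ => h1 i, sum_subtype_eq_sum_ite Y.verts fun i =>
    ∑ j : V, if i < j ∧ Y.Adj i j then edgeTerm u (t / T) i j else 0]
  refine Finset.sum_congr rfl fun i _ => ?_
  by_cases hi : i ∈ Y.verts
  · rw [if_pos hi]
  · rw [if_neg hi]
    exact (Finset.sum_eq_zero fun j _ => if_neg fun h => hi (Y.edge_vert h.2)).symm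

end Subgraph

/-! ### The distance from a subgraph, capped at the radius -/

section CappedDist

variable {V : Type*} {G : SimpleGraph V}

/-- The minimum of `r` and of the distance from `X` to `w`. -/
noncomputable def cappedDist (X : G.Subgraph) (r : ℕ) (w : V) : ℕ :=
  sInf {k | k = r ∨ ∃ a ∈ X.verts, ∃ p : G.Walk a w, p.length = k}

theorem cappedDist_mem (X : G.Subgraph) (r : ℕ) (w : V) :
    cappedDist X r w = r ∨ ∃ a ∈ X.verts, ∃ p : G.Walk a w, p.length = cappedDist X r w :=
  Nat.sInf_mem (s := {k | k = r ∨ ∃ a ∈ X.verts, ∃ p : G.Walk a w, p.length = k}) ⟨r, Or.inl rfl⟩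

theorem cappedDist_le (X : G.Subgraph) (r : ℕ) (w : V) : cappedDist X r w ≤ r :=
  Nat.sInf_le (Or.inl rfl)

theorem cappedDist_le_length {X : G.Subgraph} (r : ℕ) {a w : V} (ha : a ∈ X.verts)
    (p : G.Walk a w) : cappedDist X r w ≤ p.length :=
  Nat.sInf_le (Or.inr ⟨a, ha, p, rfl⟩)

theorem cappedDist_eq_zero {X : G.Subgraph} (r : ℕ) {w : V} (hw : w ∈ X.verts) :
    cappedDist X r w = 0 :=
  Nat.le_zero.1 (cappedDist_le_length r hw SimpleGraph.Walk.nil)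

/-- This Lipschitz property makes the exponential weights of adjacent vertices differ by a factor at
most e. -/
theorem cappedDist_le_add_one (X : G.Subgraph) (r : ℕ) {w z : V} (h : G.Adj w z) :
    cappedDist X r w ≤ cappedDist X r z + 1 := by
  rcases cappedDist_mem X r z with hz | ⟨a, ha, p, hp⟩
  · rw [hz]
    exact (cappedDist_le X r w).trans (Nat.le_succ r)
  · rw [← hp, ← SimpleGraph.Walk.length_concat p h.symm]
    exact cappedDist_le_length r ha _

theorem exists_path_of_cappedDist_ne {X : G.Subgraph} {r : ℕ} {w : V} (h : cappedDist X r w ≠ r) :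
    ∃ a ∈ X.verts, ∃ p : G.Walk a w, p.IsPath ∧ p.length < r := by
  classical
  obtain ⟨a, ha, p, hp⟩ := (cappedDist_mem X r w).resolve_left h
  refine ⟨a, ha, p.bypass, p.bypass_isPath, p.length_bypass_le_length.trans_lt ?_⟩
  rw [hp]
  exact lt_of_le_of_ne (cappedDist_le X r w) h

theorem cappedDist_of_notMem_ball {X : G.Subgraph} {r : ℕ} {w : V} (h : w ∉ (ball X r).verts) :
    cappedDist X r w = r := by
  by_contra hw
  obtain ⟨a, ha, p, hp, hl⟩ := exists_path_of_cappedDist_ne hw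
  exact h (Or.inr ⟨a, ha, w, p, hp, hl.le, p.end_mem_support⟩)

/-- If a path from `X` reaches `w` in fewer than `r` steps, the edge to `z` lies on a path of length
at most `r`: prolong the path to `z`, or, when it already meets `z`, cut it there and step to `w`.
By symmetry both ends of a missing edge have capped distance `r`. -/
theorem cappedDist_of_not_ball_adj {X : G.Subgraph} {r : ℕ} {w z : V} (hwz : G.Adj w z)
    (h : ¬ (ball X r).Adj w z) : cappedDist X r w = r := by
  classical
  by_contra hw
  obtain ⟨a, ha, p, hp, hl⟩ := exists_path_of_cappedDist_ne hw
  by_cases hz : z ∈ p.support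
  · refine h (Or.inr ⟨a, ha, w, (p.takeUntil z hz).concat hwz.symm, ?_, ?_, ?_⟩)
    · exact (hp.takeUntil hz).concat
        (SimpleGraph.Walk.endpoint_notMem_support_takeUntil hp hz hwz.ne) hwz.symm
    · rw [SimpleGraph.Walk.length_concat]
      exact (Nat.succ_le_succ (p.length_takeUntil_le_length hz)).trans hl
    · rw [SimpleGraph.Walk.edges_concat, Sym2.eq_swap]
      simp
  · refine h (Or.inr ⟨a, ha, z, p.concat hwz, hp.concat hz hwz, ?_, ?_⟩)
    · rw [SimpleGraph.Walk.length_concat]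
      exact hl
    · rw [SimpleGraph.Walk.edges_concat]
      simp

end CappedDist

/-! ### Locality of the annealing evolution -/

section Locality

variable {V : Type*} [Fintype V] [LinearOrder V]

/-- The number of neighbours controls a sum over the edges. -/
theorem sum_sum_adj_le {V : Type*} [Fintype V] {G : SimpleGraph V} [DecidableRel G.Adj] {d : ℕ} (hd : ∀ w, G.degree w ≤ d)
    {o : V → ℝ} (ho : ∀ w, 0 ≤ o w) :
    (∑ i, ∑ j, if G.Adj i j then o i + o j else 0) ≤ 2 * d * ∑ i, o i := by
  have h : ∀ i, (∑ j, if G.Adj i j then o i else 0) ≤ d * o i := by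
    intro i
    rw [← Finset.sum_filter, Finset.sum_const, nsmul_eq_mul]
    refine mul_le_mul_of_nonneg_right ?_ (ho i)
    have := hd i
    rw [← G.card_neighborFinset_eq_degree, G.neighborFinset_eq_filter] at this
    exact_mod_cast this
  have e : ∀ i j, (if G.Adj i j then o i + o j else 0) =
      (if G.Adj i j then o i else 0) + if G.Adj j i then o j else 0 := by
    intro i j
    simp only [G.adj_comm j i]
    split_ifs <;> simp
  simp only [e, Finset.sum_add_distrib]
  rw [Finset.sum_comm (f := fun i j => if G.Adj j i then o j else 0), ← two_mul, mul_assoc]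
  refine mul_le_mul_of_nonneg_left ?_ zero_le_two
  rw [Finset.mul_sum]
  exact Finset.sum_le_sum fun i _ => h i

/-- The terms of the Hamiltonian missing from the ball of radius `r` are far away. -/
theorem norm_comm_hamiltonian_sub_le {v : Bool → ℝ} {u : Bool → Bool → ℝ} {J : ℝ}
    (hv : ∀ a, |v a| ≤ J) (hu : ∀ a b, |u a b| ≤ J) {G : SimpleGraph V} [DecidableRel G.Adj]
    {d : ℕ} (hd : ∀ w, G.degree w ≤ d) (X : G.Subgraph) (r : ℕ) {T s : ℝ} (hT : 0 < T)
    (hs : s ∈ Set.Icc 0 T) (a : Matrix (V → Bool) (V → Bool) ℂ) :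
    ‖comm (hamiltonian v u G T s - extendOp Subtype.val (hamiltonian v u (ball X r).coe T s)) a‖ ≤
      (1 + 6 * J) * (1 + 2 * d) * Real.exp (-r) *
        ∑ w, Real.exp (cappedDist X r w) * oscillation generator w a := by
  classical
  have hJ : 0 ≤ J := (abs_nonneg _).trans (hv false)
  have hc : s / T ∈ Set.Icc (0 : ℝ) 1 :=
    ⟨div_nonneg hs.1 hT.le, (div_le_one hT).2 hs.2⟩
  have L := isLocal_terms hv hu G (fun i j => i < j ∧ G.Adj i j) (fun _ _ h => h.2) hc
  have e1 : hamiltonian v u G T s - extendOp Subtype.val (hamiltonian v u (ball X r).coe T s) =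
      (∑ i, if i ∈ (ball X r).verts then 0 else siteTerm v (s / T) i) +
      ∑ i, ∑ j, if (ball X r).Adj i j then 0 else
        if i < j ∧ G.Adj i j then edgeTerm u (s / T) i j else 0 := by
    rw [hamiltonian_eq_sum, extendOp_hamiltonian_coe, add_sub_add_comm, ← Finset.sum_sub_distrib,
      ← Finset.sum_sub_distrib]
    congr 1
    · refine Finset.sum_congr rfl fun i _ => ?_
      split_ifs <;> simp
    · refine Finset.sum_congr rfl fun i _ => ?_
      rw [← Finset.sum_sub_distrib]
      refine Finset.sum_congr rfl fun j _ => ?_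
      by_cases hb : (ball X r).Adj i j
      · simp [hb, (ball X r).adj_sub hb]
      · simp [hb]
  -- The normalisation makes `o` equal to the oscillation where the capped distance is `r`, which
  -- holds at all vertices of missing terms; elsewhere `o` is nonnegative, so the sums may run over
  -- the whole graph.
  let o : V → ℝ := fun w => Real.exp (-r) * (Real.exp (cappedDist X r w) * oscillation generator w a)
  have ho : ∀ w, 0 ≤ o w := fun w =>
    mul_nonneg (Real.exp_pos _).le (mul_nonneg (Real.exp_pos _).le (oscillation_nonneg _ _ _))
  have hoe : ∀ w, cappedDist X r w = r → oscillation generator w a = o w := by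
    intro w hw
    simp only [o]
    rw [hw, ← mul_assoc, ← Real.exp_add]
    simp
  have h1 : ∀ i, ‖comm (if i ∈ (ball X r).verts then 0 else siteTerm v (s / T) i) a‖ ≤
      (1 + 6 * J) * o i := by
    intro i
    split_ifs with hi
    · rw [zero_comm, norm_zero]
      exact mul_nonneg (by positivity) (ho i)
    · rw [← hoe i (cappedDist_of_notMem_ball hi)]
      exact L.site_comm_le i a
  have h2 : ∀ i j, ‖comm (if (ball X r).Adj i j then 0 else
      if i < j ∧ G.Adj i j then edgeTerm u (s / T) i j else 0) a‖ ≤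
      (1 + 6 * J) * if G.Adj i j then o i + o j else 0 := by
    intro i j
    by_cases hG : G.Adj i j
    · rw [if_pos hG]
      split_ifs with hb hij
      · rw [zero_comm, norm_zero]
        exact mul_nonneg (by positivity) (add_nonneg (ho i) (ho j))
      · have := L.edge_comm_le i j a
        rw [if_pos hij] at this
        rwa [← hoe i (cappedDist_of_not_ball_adj hG hb),
          ← hoe j (cappedDist_of_not_ball_adj hG.symm fun h => hb h.symm)]
      · rw [zero_comm, norm_zero]
        exact mul_nonneg (by positivity) (add_nonneg (ho i) (ho j))
    · simp [hG, zero_comm]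
  rw [e1, add_comm_left, sum_comm_left, sum_comm_left]
  simp only [sum_comm_left]
  refine (norm_add_le _ _).trans ((add_le_add (norm_sum_le_of_le _ fun i _ => h1 i)
    (norm_sum_le_of_le _ fun i _ => norm_sum_le_of_le _ fun j _ => h2 i j)).trans ?_)
  simp only [← Finset.mul_sum]
  have h3 := mul_le_mul_of_nonneg_left (sum_sum_adj_le hd ho) (show 0 ≤ 1 + 6 * J by positivity)
  have h4 : ∑ i, o i = Real.exp (-r) *
      ∑ w, Real.exp (cappedDist X r w) * oscillation generator w a := by
    simp only [o, ← Finset.mul_sum]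
  rw [h4] at h3 ⊢
  refine (add_le_add le_rfl h3).trans (le_of_eq ?_)
  ring

/-- The oscillations of an observable on `X` are supported on `X`. -/
theorem sum_oscillation_extendOp_le {G : SimpleGraph V} (X : G.Subgraph) (r : ℕ) {m : ℕ}
    (hm : X.verts.ncard ≤ m) (O : Matrix (X.verts → Bool) (X.verts → Bool) ℂ) :
    ∑ w, Real.exp (cappedDist X r w) * oscillation generator w (extendOp Subtype.val O) ≤
      4 * m * ‖O‖ := by
  classical
  have h : ∀ w, Real.exp (cappedDist X r w) * oscillation generator w (extendOp Subtype.val O) ≤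
      if w ∈ X.verts then 4 * ‖O‖ else 0 := by
    intro w
    split_ifs with hw
    -- On `X` the weight is one, and two generators with commutators of norm at most `2 * ‖O‖` give
    -- the factor `4`.
    · rw [cappedDist_eq_zero r hw, Nat.cast_zero, Real.exp_zero, one_mul]
      have h1 : ∀ b, ‖comm (generator w b) (extendOp Subtype.val O)‖ ≤ 2 * ‖O‖ := fun b => by
        refine (norm_comm_le _ _).trans ?_
        have h2 := norm_extendOp_le (Subtype.val_injective (p := (· ∈ X.verts))) O
        exact mul_le_mul (by linarith [norm_generator_le w b]) h2 (norm_nonneg _) zero_le_two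
      refine (Finset.sum_le_sum fun b _ => h1 b).trans (le_of_eq ?_)
      simp
      ring
    · refine le_of_eq (mul_eq_zero_of_right _ (Finset.sum_eq_zero fun b _ => ?_))
      rw [comm_eq_zero_of_commute (commute_extendOp_generator (by simpa using hw) O b).symm,
        norm_zero]
  refine (Finset.sum_le_sum fun w _ => h w).trans ?_
  rw [← Finset.sum_filter, Finset.sum_const, nsmul_eq_mul, mul_assoc, mul_left_comm]
  have : (Finset.univ.filter (· ∈ X.verts)).card ≤ m := by
    rwa [Set.ncard_eq_toFinset_card', Set.toFinset_card, Fintype.card_subtype] at hm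
  have : ((Finset.univ.filter (· ∈ X.verts)).card : ℝ) ≤ m := by exact_mod_cast this
  gcongr

/-- The growth rate of the oscillations. -/
noncomputable def growthRate (J : ℝ) (d : ℕ) : ℝ :=
  8 * (1 + 6 * J) + 16 * (1 + 6 * J) * d * (1 + Real.exp 1)

theorem growthRate_nonneg {J : ℝ} (hJ : 0 ≤ J) (d : ℕ) : 0 ≤ growthRate J d := by
  unfold growthRate
  positivity

theorem sum_norm_comm_comm_hamiltonian_le {v : Bool → ℝ} {u : Bool → Bool → ℝ} {J : ℝ}
    (hv : ∀ a, |v a| ≤ J) (hu : ∀ a b, |u a b| ≤ J) {G : SimpleGraph V} [DecidableRel G.Adj]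
    {d : ℕ} (hd : ∀ w, G.degree w ≤ d) (X : G.Subgraph) (r : ℕ) {T s : ℝ} (hT : 0 < T)
    (hs : s ∈ Set.Icc 0 T) (a : Matrix (V → Bool) (V → Bool) ℂ) :
    ∑ w, ∑ b, Real.exp (cappedDist X r w) * ‖comm (comm (hamiltonian v u G T s) (generator w b)) a‖
      ≤ growthRate J d * ∑ w, Real.exp (cappedDist X r w) * oscillation generator w a := by
  classical
  have hJ : 0 ≤ J := (abs_nonneg _).trans (hv false)
  have hc : s / T ∈ Set.Icc (0 : ℝ) 1 :=
    ⟨div_nonneg hs.1 hT.le, (div_le_one hT).2 hs.2⟩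
  have L := isLocal_terms hv hu G (fun i j => i < j ∧ G.Adj i j) (fun _ _ h => h.2) hc
  rw [hamiltonian_eq_sum]
  refine L.sum_weight_mul_norm_comm_comm_le (by positivity) hd (fun w => (Real.exp_pos _).le)
    (fun w z h => ?_) (Real.exp_pos 1).le a
  rw [← Real.exp_add, Real.exp_le_exp, add_comm]
  exact_mod_cast cappedDist_le_add_one X r h

theorem extendOp_heisenberg_extendOp {ι κ : Type*} [Fintype ι] [LinearOrder ι] {f : ι → V}
    (hf : f.Injective) (g : κ → ι) (v : Bool → ℝ) (u : Bool → Bool → ℝ) (G : SimpleGraph ι) (T : ℝ)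
    (O : Matrix (κ → Bool) (κ → Bool) ℂ) :
    extendOp f (heisenberg v u G T (extendOp g O)) =
      star (extendOp f (evolution v u G T T)) * extendOp (f ∘ g) O *
        extendOp f (evolution v u G T T) := by
  rw [heisenberg, extendOp_mul hf, extendOp_mul hf, extendOp_extendOp hf, extendOp_conjTranspose]
  rfl

theorem isSchrodinger_extendOp_evolution {ι : Type*} [Fintype ι] [LinearOrder ι] {f : ι → V}
    (hf : f.Injective) (v : Bool → ℝ) (u : Bool → Bool → ℝ) (G : SimpleGraph ι) (T : ℝ) :
    IsSchrodinger (fun t => extendOp f (hamiltonian v u G T t))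
      (fun t => extendOp f (evolution v u G T t)) :=
  (isSchrodinger_evolution v u G T).map (extendHom hf)

/-- Locality of the annealing evolution, with explicit constants. -/
theorem norm_heisenberg_sub_le {v : Bool → ℝ} {u : Bool → Bool → ℝ} {J : ℝ}
    (hv : ∀ a, |v a| ≤ J) (hu : ∀ a b, |u a b| ≤ J) {d m : ℕ} (G : SimpleGraph V)
    [DecidableRel G.Adj] (hd : ∀ w, G.degree w ≤ d) (X : G.Subgraph) (hm : X.verts.ncard ≤ m)
    (O : Matrix (X.verts → Bool) (X.verts → Bool) ℂ) {T : ℝ} (hT : 0 < T) {r : ℕ}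
    (hr : 2 * (growthRate J d + 1) * T ≤ r) :
    ‖heisenberg v u G T (extendOp Subtype.val O) -
      extendOp Subtype.val (heisenberg v u (ball X r).coe T
        (extendOp (Set.inclusion (verts_subset_ball X r)) O))‖ ≤
      ((1 + 6 * J) * (1 + 2 * d) * (4 * m) + 1) * ‖O‖ * Real.exp (-(1 / 2) * r) := by
  have hJ : 0 ≤ J := (abs_nonneg _).trans (hv false)
  have hf : Function.Injective (Subtype.val : (ball X r).verts → V) := Subtype.val_injective
  have hU := isSchrodinger_evolution v u G T
  have hW := isSchrodinger_extendOp_evolution hf v u (ball X r).coe T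
  have key := hU.norm_conj_sub_conj_le hW generator (q := fun w => Real.exp (cappedDist X r w))
    (fun w => (Real.exp_pos _).le) (κ := growthRate J d) (T := T)
    (M := (1 + 6 * J) * (1 + 2 * d) * Real.exp (-r)) hT.le (growthRate_nonneg hJ d)
    (by positivity) (fun s hs a => sum_norm_comm_comm_hamiltonian_le hv hu hd X r hT hs a)
    (fun s hs a => norm_comm_hamiltonian_sub_le hv hu hd X r hT hs a) (extendOp Subtype.val O)
  rw [extendOp_heisenberg_extendOp hf]
  refine key.trans ?_
  have hS := sum_oscillation_extendOp_le X r hm O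
  -- The factor `T` from integrating in time is absorbed into an exponential. This accounts for the
  -- `+ 1` in `hr`, and the `2` there leaves half of the decay in `r`.
  have hTe : T ≤ Real.exp T := by linarith [Real.add_one_le_exp T]
  have hexp : Real.exp (-r) * Real.exp (growthRate J d * T) * Real.exp T ≤
      Real.exp (-(1 / 2) * r) := by
    rw [← Real.exp_add, ← Real.exp_add, Real.exp_le_exp]
    linarith
  calc _ ≤ (1 + 6 * J) * (1 + 2 * d) * Real.exp (-r) *
        ((4 * m * ‖O‖) * Real.exp (growthRate J d * T)) * Real.exp T := by gcongr
    _ = (1 + 6 * J) * (1 + 2 * d) * (4 * m) * ‖O‖ *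
        (Real.exp (-r) * Real.exp (growthRate J d * T) * Real.exp T) := by ring
    _ ≤ (1 + 6 * J) * (1 + 2 * d) * (4 * m) * ‖O‖ * Real.exp (-(1 / 2) * r) := by gcongr
    _ ≤ _ := by
      gcongr
      linarith

/-! ### Expected values -/

theorem expectedValue_eq (v : Bool → ℝ) (u : Bool → Bool → ℝ) (G : SimpleGraph V) (T : ℝ)
    (A : Matrix (V → Bool) (V → Bool) ℂ) :
    expectedValue v u G T A =
      dotProduct (star (uniformState V)) (Matrix.mulVec (heisenberg v u G T A) (uniformState V)) := by
  rw [expectedValue, finalState, heisenberg, Matrix.star_mulVec, ← Matrix.dotProduct_mulVec,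
    Matrix.mulVec_mulVec, Matrix.mulVec_mulVec, Matrix.mul_assoc]

theorem uniform_dotProduct (M : Matrix (V → Bool) (V → Bool) ℂ) :
    dotProduct (star (uniformState V)) (Matrix.mulVec M (uniformState V)) =
      (2 : ℂ)⁻¹ ^ Fintype.card V * ∑ x, ∑ y, M x y := by
  have h : star (((Real.sqrt 2 : ℝ) : ℂ)⁻¹ ^ Fintype.card V) *
      ((Real.sqrt 2 : ℝ) : ℂ)⁻¹ ^ Fintype.card V = (2 : ℂ)⁻¹ ^ Fintype.card V := by
    have h2 : ((Real.sqrt 2 : ℝ) : ℂ)⁻¹ * ((Real.sqrt 2 : ℝ) : ℂ)⁻¹ = (2 : ℂ)⁻¹ := by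
      rw [← mul_inv, ← Complex.ofReal_mul, Real.mul_self_sqrt zero_le_two]
      simp
    rw [star_pow, star_inv₀, Complex.star_def, Complex.conj_ofReal, ← mul_pow, h2]
  simp only [dotProduct, Matrix.mulVec, uniformState, Pi.star_apply, ← Finset.sum_mul]
  simp only [← h, Finset.sum_mul, Finset.mul_sum]
  refine Finset.sum_congr rfl fun x _ => Finset.sum_congr rfl fun y _ => ?_
  ring

/-- A function of the bits in the range of `f`, summed over all bit strings. -/
theorem sum_comp_eq {ι : Type*} [Fintype ι] [DecidableEq ι] {f : ι → V} (hf : f.Injective)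
    (F : (ι → Bool) → ℂ) :
    (2 : ℂ) ^ Fintype.card ι * ∑ x : V → Bool, F (x ∘ f) =
      (2 : ℂ) ^ Fintype.card V * ∑ w, F w := by
  classical
  -- Double counting of the pairs of strings that agree off the range of `f`.
  have h1 : ∑ x : V → Bool, ∑ z : V → Bool,
      (if ∀ i, i ∉ Set.range f → x i = z i then F (z ∘ f) else 0) =
      (2 : ℂ) ^ Fintype.card V * ∑ w, F w := by
    rw [Finset.sum_congr rfl fun x _ => sum_eq_off_range hf x fun z => F (z ∘ f)]
    simp [extend_comp hf]
  rw [← h1, Finset.sum_comm, Finset.mul_sum]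
  refine Finset.sum_congr rfl fun z _ => ?_
  have h2 := sum_eq_off_range hf z fun _ => F (z ∘ f)
  simp only [Finset.sum_const, Finset.card_univ, Fintype.card_fun, Fintype.card_bool,
    nsmul_eq_mul, Nat.cast_pow, Nat.cast_ofNat] at h2
  rw [← h2]
  refine Finset.sum_congr rfl fun x _ => if_congr ?_ rfl rfl
  exact forall₂_congr fun i _ => eq_comm

/-- The uniform superposition is a product state, so the qubits outside the range contribute a
factor one. -/
theorem uniform_dotProduct_extendOp {ι : Type*} [Fintype ι] [LinearOrder ι] {f : ι → V}
    (hf : f.Injective) (M : Matrix (ι → Bool) (ι → Bool) ℂ) :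
    dotProduct (star (uniformState V)) (Matrix.mulVec (extendOp f M) (uniformState V)) =
      dotProduct (star (uniformState ι)) (Matrix.mulVec M (uniformState ι)) := by
  classical
  have h1 : ∑ x, ∑ y, extendOp f M x y = ∑ x : V → Bool, ∑ w, M (x ∘ f) w := by
    refine Finset.sum_congr rfl fun x _ => ?_
    simp only [extendOp_apply]
    refine (sum_eq_off_range (hdec := fun _ => Classical.propDecidable _) hf x
      fun y => M (x ∘ f) (y ∘ f)).trans ?_
    simp only [extend_comp hf]
  have h2 : (2 : ℂ) ^ Fintype.card ι * ∑ x : V → Bool, ∑ w, M (x ∘ f) w =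
      (2 : ℂ) ^ Fintype.card V * ∑ x, ∑ w, M x w :=
    sum_comp_eq hf fun x => ∑ w, M x w
  rw [uniform_dotProduct, uniform_dotProduct, h1, inv_pow, inv_pow,
    inv_mul_eq_iff_eq_mul₀ (pow_ne_zero _ two_ne_zero), mul_left_comm,
    eq_inv_mul_iff_mul_eq₀ (pow_ne_zero _ two_ne_zero), h2]

/-- Cauchy–Schwarz for a unit vector. -/
theorem norm_uniform_dotProduct_le (M : Matrix (V → Bool) (V → Bool) ℂ) :
    ‖dotProduct (star (uniformState V)) (Matrix.mulVec M (uniformState V))‖ ≤ ‖M‖ := by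
  have h1 : dotProduct (star (uniformState V)) (uniformState V) = 1 := by
    have := uniform_dotProduct (1 : Matrix (V → Bool) (V → Bool) ℂ)
    simpa [Matrix.one_apply] using this
  have h2 : ‖WithLp.toLp 2 (uniformState V)‖ = 1 := by
    have := inner_self_eq_norm_sq_to_K (𝕜 := ℂ) (WithLp.toLp 2 (uniformState V))
    rw [EuclideanSpace.inner_toLp_toLp, dotProduct_comm, h1] at this
    have h3 : ‖WithLp.toLp 2 (uniformState V)‖ ^ 2 = 1 := Complex.ofReal_injective (by
      simpa using this.symm)
    exact (pow_eq_one_iff_of_nonneg (norm_nonneg _) two_ne_zero).1 h3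
  have h4 := norm_inner_le_norm (𝕜 := ℂ) (WithLp.toLp 2 (uniformState V))
    (WithLp.toLp 2 (Matrix.mulVec M (uniformState V)))
  rw [EuclideanSpace.inner_toLp_toLp, dotProduct_comm, h2, one_mul] at h4
  have h5 := Matrix.l2_opNorm_mulVec M (WithLp.toLp 2 (uniformState V))
  rw [h2, mul_one] at h5
  exact h4.trans h5

/-- Locality of the expected values. -/
theorem norm_expectedValue_sub_le (v : Bool → ℝ) (u : Bool → Bool → ℝ) {ι κ : Type*} [Fintype ι]
    [LinearOrder ι] {f : ι → V} (hf : f.Injective) (g : κ → ι) (G : SimpleGraph V)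
    (G' : SimpleGraph ι) (T : ℝ) (A : Matrix (V → Bool) (V → Bool) ℂ)
    (O : Matrix (κ → Bool) (κ → Bool) ℂ) :
    ‖expectedValue v u G T A - expectedValue v u G' T (extendOp g O)‖ ≤
      ‖heisenberg v u G T A - extendOp f (heisenberg v u G' T (extendOp g O))‖ := by
  rw [expectedValue_eq, expectedValue_eq, ← uniform_dotProduct_extendOp hf, ← dotProduct_sub,
    ← Matrix.sub_mulVec]
  exact norm_uniform_dotProduct_le _

end Locality

end QuantumAnnealing

theorem mainTheorem4 (v : Bool → ℝ) (u : Bool → Bool → ℝ) (d m : ℕ) :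
    (∀ ε : ℝ, 0 < ε → ∀ T : ℝ, 0 < T → ∀ K : ℝ, ∃ r₀ : ℕ, ∀ r : ℕ, r₀ ≤ r →
      ∀ (V : Type*) [Fintype V] [LinearOrder V] (G : SimpleGraph V) [DecidableRel G.Adj],
        (∀ w, G.degree w ≤ d) →
      ∀ X : G.Subgraph, X.verts.ncard ≤ m →
      ∀ O : Matrix (X.verts → Bool) (X.verts → Bool) ℂ, O.IsHermitian → ‖O‖ ≤ K →
        ‖QuantumAnnealing.expectedValue v u G T (QuantumAnnealing.extendOp Subtype.val O) -
          QuantumAnnealing.expectedValue v u (QuantumAnnealing.ball X r).coe T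
            (QuantumAnnealing.extendOp
              (Set.inclusion (QuantumAnnealing.verts_subset_ball X r)) O)‖ ≤ ε) ∧
    (∃ vLR μ C : ℝ, 0 < vLR ∧ 0 < μ ∧ 0 < C ∧
      ∀ (V : Type*) [Fintype V] [LinearOrder V] (G : SimpleGraph V) [DecidableRel G.Adj],
        (∀ w, G.degree w ≤ d) →
      ∀ X : G.Subgraph, X.verts.ncard ≤ m →
      ∀ O : Matrix (X.verts → Bool) (X.verts → Bool) ℂ, O.IsHermitian →
      ∀ T : ℝ, 0 < T → ∀ r : ℕ, vLR * T ≤ r →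
        ‖QuantumAnnealing.heisenberg v u G T (QuantumAnnealing.extendOp Subtype.val O) -
          QuantumAnnealing.extendOp Subtype.val
            (QuantumAnnealing.heisenberg v u (QuantumAnnealing.ball X r).coe T
              (QuantumAnnealing.extendOp
                (Set.inclusion (QuantumAnnealing.verts_subset_ball X r)) O))‖
          ≤ C * ‖O‖ * Real.exp (-μ * r)) := by
  set J : ℝ := ∑ a, |v a| + ∑ a, ∑ b, |u a b| with hJdef
  have hv0 : 0 ≤ ∑ a, |v a| := Finset.sum_nonneg fun _ _ => abs_nonneg _
  have hu0 : 0 ≤ ∑ a, ∑ b, |u a b| :=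
    Finset.sum_nonneg fun _ _ => Finset.sum_nonneg fun _ _ => abs_nonneg _
  have hJ : 0 ≤ J := add_nonneg hv0 hu0
  have hv : ∀ a, |v a| ≤ J := fun a =>
    (Finset.single_le_sum (f := fun a => |v a|) (fun _ _ => abs_nonneg _)
      (Finset.mem_univ a)).trans (le_add_of_nonneg_right hu0)
  have hu : ∀ a b, |u a b| ≤ J := fun a b =>
    ((Finset.single_le_sum (f := fun b => |u a b|) (fun _ _ => abs_nonneg _)
      (Finset.mem_univ b)).trans (Finset.single_le_sum (f := fun a => ∑ b, |u a b|)
        (fun _ _ => Finset.sum_nonneg fun _ _ => abs_nonneg _) (Finset.mem_univ a))).trans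
      (le_add_of_nonneg_left hv0)
  have hg := QuantumAnnealing.growthRate_nonneg hJ d
  -- The summand `1` keeps the constant positive when `m = 0`.
  set C : ℝ := (1 + 6 * J) * (1 + 2 * d) * (4 * m) + 1 with hC
  have hC0 : 0 < C := by positivity
  refine ⟨fun ε hε T hT K => ?_, 2 * (QuantumAnnealing.growthRate J d + 1), 1 / 2, C,
    by positivity, by norm_num, hC0, ?_⟩
  · have hlim : Filter.Tendsto (fun r : ℕ => C * |K| * Real.exp (-(1 / 2) * r)) Filter.atTop
        (nhds 0) := by
      have h1 : Filter.Tendsto (fun r : ℕ => (1 / 2 : ℝ) * r) Filter.atTop Filter.atTop :=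
        tendsto_natCast_atTop_atTop.const_mul_atTop (by norm_num)
      have h2 := (Real.tendsto_exp_neg_atTop_nhds_zero.comp h1).const_mul (C * |K|)
      simpa [Function.comp_def] using h2
    obtain ⟨r₁, hr₁⟩ := Filter.eventually_atTop.1 (hlim.eventually (gt_mem_nhds hε))
    obtain ⟨r₂, hr₂⟩ := exists_nat_ge (2 * (QuantumAnnealing.growthRate J d + 1) * T)
    -- Beyond `r₂` the locality bound is valid for the runtime `T`; beyond `r₁` its right-hand side
    -- is below `ε`. Neither depends on the graph.
    refine ⟨max r₁ r₂, fun r hr V _ _ G _ hd X hm O _ hO => ?_⟩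
    have hr2 : (r₂ : ℝ) ≤ r := by exact_mod_cast (le_max_right _ _).trans hr
    have h1 := QuantumAnnealing.norm_heisenberg_sub_le hv hu G hd X hm O hT (hr₂.trans hr2)
    have h2 := hr₁ r ((le_max_left _ _).trans hr)
    refine (QuantumAnnealing.norm_expectedValue_sub_le v u Subtype.val_injective
      (Set.inclusion (QuantumAnnealing.verts_subset_ball X r)) G _ T _ O).trans (h1.trans ?_)
    refine le_trans ?_ h2.le
    have : ‖O‖ ≤ |K| := hO.trans (le_abs_self K)
    gcongr
  · intro V _ _ G _ hd X hm O _ T hT r hr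
    exact QuantumAnnealing.norm_heisenberg_sub_le hv hu G hd X hm O hT hr
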